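/- Let $0<r$, let $f:\mathbb{R}^{p_1\times p_2}\to\mathbb{R}$ be twice continuously differentiable, and let $g(L,R)=f(LR^\top)$ for $L\in\mathbb{R}^{p_1\times r}$, $R\in\mathbb{R}^{p_2\times r}$, regarded as a function of the stacked matrix $[L^\top\ R^\top]^\top\in\mathbb{R}^{(p_1+p_2)\times r}$. All matrix spaces carry the inner product $\langle A,B\rangle=\operatorname{tr}(A^\top B)$, and $\mathcal{M}_r=\{X\in\mathbb{R}^{p_1\times p_2}:\operatorname{rank}X=r\}$ carries the induced Riemannian metric. Write $\nabla,\nabla^2$ for Euclidean gradients and Hessians, and $\operatorname{grad}f(X)$, $\operatorname{Hess}f(X)$ for the Riemannian gradient and Hessian of $f$ on $\mathcal{M}_r$; Hessians are linear operators, with $\nabla^2 g(L,R)[A,B]=\langle\nabla^2 g(L,R)[A],B\rangle$ and likewise for $\operatorname{Hess}f(X)$. $M^\dagger$ is the Moore–Penrose inverse, $\sigma_k$ is the $k$-th largest singular value and $\lambda_k$ the $k$-th largest eigenvalue, counted with multiplicity. Suppose that $L$, $R$ and $X=LR^\top$ all have rank $r$. Then $$\operatorname{grad}f(X)=\nabla_L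 g(L,R)\,R^\dagger+\bigl(\nabla_R g(L,R)\,L^\dagger\bigr)^\top(I_{p_2}-RR^\dagger),\qquad \nabla g(L,R)=\begin{bmatrix}\operatorname{grad}f(X)\,R\\ (\operatorname{grad}f(X))^\top L\end{bmatrix}.$$ The operators $\operatorname{Hess}f(X)$ and $\nabla^2 g(L,R)$ are self-adjoint and have, counted with multiplicity, $(p_1+p_2-r)r$ and $(p_1+p_2)r$ real eigenvalues, respectively. Suppose in addition that $\nabla g(L,R)=0$. Let $X=U\Sigma V^\top$ be any economic singular value decomposition, let $U_\perp,V_\perp$ be orthonormal complements of $U,V$, and put $P_1=U^\top L$, $P_2=V^\top R$. For $A=[A_L^\top\ A_R^\top]^\top\in\mathbb{R}^{(p_1+p_2)\times r}$ let $$\xi^A=[U\ U_\perp]\begin{bmatrix}P_1A_R^\top V+U^\top A_LP_2^\top & P_1A_R^\top V_\perp\\ U_\perp^\top A_LP_2^\top & 0\end{bmatrix}[V\ V_\perp]^\top,$$ and let $$\mathscr{A}_{\rm null}=\left\{\begin{bmatrix}USP_2^{-\top}\\-VS^\top P_1^{-\top}\end{bmatrix}:S\in\mathbb{R}^{r\times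 r}\right\},\qquad \mathscr{A}_{\overline{\rm null}}=\left\{\begin{bmatrix}(USP_2P_2^\top+U_\perp D_1)P_2^{-\top}\\(VS^\top P_1P_1^\top+V_\perp D_2)P_1^{-\top}\end{bmatrix}:S\in\mathbb{R}^{r\times r},\ D_1\in\mathbb{R}^{(p_1-r)\times r},\ D_2\in\mathbb{R}^{(p_2-r)\times r}\right\}.$$ Then: 1. For every $A\in\mathbb{R}^{(p_1+p_2)\times r}$, $\xi^A\in T_X\mathcal{M}_r$ and $\nabla^2 g(L,R)[A,A]=\operatorname{Hess}f(X)[\xi^A,\xi^A]$. 2. The map $\mathcal{L}:\mathscr{A}_{\overline{\rm null}}\to T_X\mathcal{M}_r$, $A\mapsto\xi^A$, is a linear bijection; $\operatorname{Hess}f(X)[\xi,\xi]=\nabla^2 g(L,R)[\mathcal{L}^{-1}(\xi),\mathcal{L}^{-1}(\xi)]$ for all $\xi\in T_X\mathcal{M}_r$, and $\nabla^2 g(L,R)[A,A]=\operatorname{Hess}f(X)[\mathcal{L}(A),\mathcal{L}(A)]$ for all $A\in\mathscr{A}_{\overline{\rm null}}$. 3. $\nabla^2 g(L,R)[A]=0$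 for all $A\in\mathscr{A}_{\rm null}$, and $\dim\mathscr{A}_{\rm null}=r^2$; in particular $\nabla^2 g(L,R)$ has at least $r^2$ zero eigenvalues. 4. Let $\bar\lambda_1\ge\cdots\ge\bar\lambda_{(p_1+p_2-r)r}$ be the eigenvalues of $\nabla^2 g(L,R)$ that remain after $r^2$ zero eigenvalues are removed. For $i=1,\dots,(p_1+p_2-r)r$, $\bar\lambda_i$ lies in the closed interval with endpoints (in whichever order) $(\sigma_r(L)\wedge\sigma_r(R))^2\,\lambda_i(\operatorname{Hess}f(X))$ and $2(\sigma_1(L)\vee\sigma_1(R))^2\,\lambda_i(\operatorname{Hess}f(X))$. -/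

import Mathlib

open scoped Matrix Matrix.Norms.Frobenius InnerProductSpace ContDiff Topology

noncomputable section

/-- The Euclidean (Frobenius) inner product `⟨A, B⟩ = trace (Aᵀ B)` on real matrices. The norm it
induces is the Frobenius norm opened above. -/
instance matrixFrobeniusInner {m n : Type*} [Fintype m] [Fintype n] :
    InnerProductSpace ℝ (Matrix m n ℝ) where
  inner A B := (Aᵀ * B).trace
  norm_sq_eq_re_inner A := by
    rw [Matrix.frobenius_norm_def, ← Real.sqrt_eq_rpow, Real.sq_sqrt (by positivity)]
    simp only [Matrix.trace, Matrix.diag_apply, Matrix.mul_apply, Matrix.transpose_apply,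
      RCLike.re_to_real, Real.rpow_two, Real.norm_eq_abs, sq_abs]
    rw [Finset.sum_comm]
    simp only [sq]
  conj_inner_symm A B := by
    simp only [conj_trivial]
    rw [← Matrix.trace_transpose, Matrix.transpose_mul, Matrix.transpose_transpose]
  add_left A B C := by
    simp [Matrix.transpose_add, Matrix.add_mul]
  smul_left A B c := by
    simp [Matrix.transpose_smul]

section EmbeddedGeometry

variable {E : Type*} [NormedAddCommGroup E] [InnerProductSpace ℝ E] [FiniteDimensional ℝ E]

/-- The tangent space at `x` of a subset `M` of a Euclidean space: the linear span of the velocities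
at time `0` of the smooth curves through `x` that stay in `M` near time `0`. If `M` is an embedded
submanifold and `x ∈ M`, these velocities already form the usual tangent space. -/
def tangentSpaceAt (M : Set E) (x : E) : Submodule ℝ E :=
  Submodule.span ℝ {v : E | ∃ γ : ℝ → E, ContDiff ℝ ∞ γ ∧ γ 0 = x ∧
    (∀ᶠ t in 𝓝 (0 : ℝ), γ t ∈ M) ∧ HasDerivAt γ v 0}

/-- The Riemannian gradient at `x`, for the metric induced on `M` by the ambient inner product: the
unique tangent vector `G` with `⟨G, Z⟩ = D F(x)[Z]` for all tangent vectors `Z`. -/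
def riemannianGradient (M : Set E) (F : E → ℝ) (x : E) : tangentSpaceAt M x :=
  haveI : CompleteSpace (tangentSpaceAt M x) := FiniteDimensional.complete ℝ _
  (InnerProductSpace.toDual ℝ (tangentSpaceAt M x)).symm
    ((fderiv ℝ F x).comp (tangentSpaceAt M x).subtypeL)

/-- The Riemannian Hessian at `x`, as an endomorphism of the tangent space: `Z` is sent to the
covariant derivative along `Z` of the Riemannian gradient field. For the Levi-Civita connection of
the induced metric this is the orthogonal projection to the tangent space of the derivative, along
`M` and in the direction `Z`, of the gradient field seen as a map into the ambient space. -/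
def riemannianHessian (M : Set E) (F : E → ℝ) (x : E) :
    tangentSpaceAt M x →ₗ[ℝ] tangentSpaceAt M x :=
  ((tangentSpaceAt M x).orthogonalProjectionOnto.comp
    ((fderivWithin ℝ (fun y : E => (riemannianGradient M F y : E)) M x).comp
      (tangentSpaceAt M x).subtypeL)).toLinearMap

/-- The Euclidean Hessian, as the linear operator that is the derivative of the gradient. -/
def euclideanHessian (F : E → ℝ) (x : E) : E →ₗ[ℝ] E :=
  haveI : CompleteSpace E := FiniteDimensional.complete ℝ E
  (fderiv ℝ (fun y : E => gradient F y) x).toLinearMap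

/-- The eigenvalues of an endomorphism, counted with multiplicity. -/
def eigenvalueMultiset (T : E →ₗ[ℝ] E) : Multiset ℝ := T.charpoly.roots

end EmbeddedGeometry

/-- The `k`-th largest element, `k = 1, 2, …`, of a finite multiset of real numbers. -/
def kthLargest (s : Multiset ℝ) (k : ℕ) : ℝ := (s.sort (· ≥ ·)).getD (k - 1) 0

/-- The `k`-th largest singular value, `k = 1, 2, …`, of a real matrix. -/
def matrixSingularValue {m n : ℕ} (A : Matrix (Fin m) (Fin n) ℝ) (k : ℕ) : ℝ :=
  (Matrix.toEuclideanLin A).singularValues (k - 1)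

/-- The four Penrose equations. -/
structure IsMoorePenroseInverse {m n : ℕ} (A : Matrix (Fin m) (Fin n) ℝ)
    (B : Matrix (Fin n) (Fin m) ℝ) : Prop where
  mul_mul_left : A * B * A = A
  mul_mul_right : B * A * B = B
  symm_left : (A * B)ᵀ = A * B
  symm_right : (B * A)ᵀ = B * A

open Classical in
/-- The Moore-Penrose inverse: the (always existing, unique) solution of the Penrose equations. -/
def moorePenrose {m n : ℕ} (A : Matrix (Fin m) (Fin n) ℝ) : Matrix (Fin n) (Fin m) ℝ :=
  if h : ∃ B, IsMoorePenroseInverse A B then h.choose else 0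

section LowRank

variable {p₁ p₂ r : ℕ}

/-- The set `M_r` of `p₁ × p₂` real matrices of rank `r`. -/
def fixedRank (p₁ p₂ r : ℕ) : Set (Matrix (Fin p₁) (Fin p₂) ℝ) := {X | X.rank = r}

/-- The objective `g(L, R) = f(L Rᵀ)`, as a function of the stacked matrix `[Lᵀ Rᵀ]ᵀ`. -/
def factorObjective (f : Matrix (Fin p₁) (Fin p₂) ℝ → ℝ)
    (W : Matrix (Fin p₁ ⊕ Fin p₂) (Fin r) ℝ) : ℝ :=
  f (W.toRows₁ * W.toRows₂ᵀ)

/-- `X = U diag(s) Vᵀ` is an economic singular value decomposition of the rank `r` matrix `X`, and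
`U'`, `V'` are orthonormal complements of `U`, `V`. -/
structure IsCompactSVD (X : Matrix (Fin p₁) (Fin p₂) ℝ)
    (U : Matrix (Fin p₁) (Fin r) ℝ) (U' : Matrix (Fin p₁) (Fin (p₁ - r)) ℝ) (s : Fin r → ℝ)
    (V : Matrix (Fin p₂) (Fin r) ℝ) (V' : Matrix (Fin p₂) (Fin (p₂ - r)) ℝ) : Prop where
  left_orthonormal : Uᵀ * U = 1
  left_compl_orthonormal : U'ᵀ * U' = 1
  left_orthogonal : Uᵀ * U' = 0
  right_orthonormal : Vᵀ * V = 1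
  right_compl_orthonormal : V'ᵀ * V' = 1
  right_orthogonal : Vᵀ * V' = 0
  pos : ∀ i, 0 < s i
  antitone : Antitone s
  eq : X = U * Matrix.diagonal s * Vᵀ

/-- The matrix `ξ^A = [U U'] [[P₁ A_Rᵀ V + Uᵀ A_L P₂ᵀ, P₁ A_Rᵀ V'], [U'ᵀ A_L P₂ᵀ, 0]] [V V']ᵀ`
with `P₁ = Uᵀ L`, `P₂ = Vᵀ R` and `A = [A_Lᵀ A_Rᵀ]ᵀ`. -/
def xiOf (U : Matrix (Fin p₁) (Fin r) ℝ) (U' : Matrix (Fin p₁) (Fin (p₁ - r)) ℝ)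
    (V : Matrix (Fin p₂) (Fin r) ℝ) (V' : Matrix (Fin p₂) (Fin (p₂ - r)) ℝ)
    (L : Matrix (Fin p₁) (Fin r) ℝ) (R : Matrix (Fin p₂) (Fin r) ℝ)
    (A : Matrix (Fin p₁ ⊕ Fin p₂) (Fin r) ℝ) : Matrix (Fin p₁) (Fin p₂) ℝ :=
  Matrix.fromCols U U' *
    Matrix.fromBlocks
      ((Uᵀ * L) * A.toRows₂ᵀ * V + Uᵀ * A.toRows₁ * (Vᵀ * R)ᵀ)
      ((Uᵀ * L) * A.toRows₂ᵀ * V')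
      (U'ᵀ * A.toRows₁ * (Vᵀ * R)ᵀ)
      0 *
    (Matrix.fromCols V V')ᵀ

/-- The subspace `A_null` of the stacked matrices `[U S P₂⁻ᵀ; -V Sᵀ P₁⁻ᵀ]`, `S ∈ ℝ^{r × r}`, with
`P₁ = Uᵀ L`, `P₂ = Vᵀ R`. -/
def nullSubspace (U : Matrix (Fin p₁) (Fin r) ℝ) (V : Matrix (Fin p₂) (Fin r) ℝ)
    (L : Matrix (Fin p₁) (Fin r) ℝ) (R : Matrix (Fin p₂) (Fin r) ℝ) :
    Submodule ℝ (Matrix (Fin p₁ ⊕ Fin p₂) (Fin r) ℝ) where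
  carrier := {A | ∃ S : Matrix (Fin r) (Fin r) ℝ,
    A = Matrix.fromRows (U * S * ((Vᵀ * R)ᵀ)⁻¹) (-(V * Sᵀ * ((Uᵀ * L)ᵀ)⁻¹))}
  zero_mem' := ⟨0, by simp⟩
  add_mem' := by
    rintro _ _ ⟨S, rfl⟩ ⟨T, rfl⟩
    refine ⟨S + T, ?_⟩
    simp only [Matrix.transpose_add, Matrix.mul_add, Matrix.add_mul, neg_add]
    ext (i | i) j <;> simp
  smul_mem' := by
    rintro c _ ⟨S, rfl⟩
    refine ⟨c • S, ?_⟩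
    ext (i | i) j <;> simp

/-- The subspace of the stacked matrices
`[(U S P₂ P₂ᵀ + U' D₁) P₂⁻ᵀ; (V Sᵀ P₁ P₁ᵀ + V' D₂) P₁⁻ᵀ]` with arbitrary `S`, `D₁`, `D₂`, where
`P₁ = Uᵀ L`, `P₂ = Vᵀ R`. -/
def nullComplement (U : Matrix (Fin p₁) (Fin r) ℝ) (U' : Matrix (Fin p₁) (Fin (p₁ - r)) ℝ)
    (V : Matrix (Fin p₂) (Fin r) ℝ) (V' : Matrix (Fin p₂) (Fin (p₂ - r)) ℝ)
    (L : Matrix (Fin p₁) (Fin r) ℝ) (R : Matrix (Fin p₂) (Fin r) ℝ) :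
    Submodule ℝ (Matrix (Fin p₁ ⊕ Fin p₂) (Fin r) ℝ) where
  carrier := {A | ∃ (S : Matrix (Fin r) (Fin r) ℝ) (D₁ : Matrix (Fin (p₁ - r)) (Fin r) ℝ)
      (D₂ : Matrix (Fin (p₂ - r)) (Fin r) ℝ),
    A = Matrix.fromRows
      ((U * S * (Vᵀ * R) * (Vᵀ * R)ᵀ + U' * D₁) * ((Vᵀ * R)ᵀ)⁻¹)
      ((V * Sᵀ * (Uᵀ * L) * (Uᵀ * L)ᵀ + V' * D₂) * ((Uᵀ * L)ᵀ)⁻¹)}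
  zero_mem' := ⟨0, 0, 0, by simp⟩
  add_mem' := by
    rintro _ _ ⟨S, D₁, D₂, rfl⟩ ⟨T, E₁, E₂, rfl⟩
    refine ⟨S + T, D₁ + E₁, D₂ + E₂, ?_⟩
    simp only [Matrix.transpose_add, Matrix.mul_add, Matrix.add_mul]
    ext (i | i) j <;> simp <;> ring
  smul_mem' := by
    rintro c _ ⟨S, D₁, D₂, rfl⟩
    refine ⟨c • S, c • D₁, c • D₂, ?_⟩
    ext (i | i) j <;> simp [← smul_add]

end LowRank

end

/-!
The map `φ(L, R) = L Rᵀ` parametrizes the rank `r` matrices near `X = L Rᵀ`, and everything follows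
from its derivative `A ↦ A_L Rᵀ + L A_Rᵀ` (`factorDeriv`), which maps onto the tangent space
(`tangentSpaceAt_fixedRank`): a curve of rank `r` matrices lifts through the smooth local section
`Y ↦ (Y R (RᵀR)⁻¹, ·)` of `φ`. Applying the resulting gradient formula
(`riemannianGradient_fixedRank`) to the factors provided by this section shows that the Riemannian
gradient field is differentiable along the rank `r` matrices, so the derivative within the set in
the definition of the Riemannian Hessian is not a junk value.

For the Hessians, `D g(W)[B] = ⟪grad f(φ W), Dφ(W)[B]⟫` holds for all `W` near `(L, R)`, and one
more derivative gives (`inner_euclideanHessian_comp`)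

`⟪∇²g [A], B⟫ = ⟪Hess f [Dφ A], Dφ B⟫ + ⟪grad f, D²φ(A, B)⟫`.

Symmetry of `Hess f` is read off from the symmetry of the two other terms. At a stationary point of
`g` the gradient of `f` is normal, the last term vanishes, and `∇²g` is the pullback of `Hess f`
along `Dφ`; the matrix `ξ^A` is `Dφ A` in singular value coordinates (`IsCompactSVD.xiOf_eq`).

The kernel of `Dφ` consists of the gauge directions `(L S, -R Sᵀ)`, and its orthogonal complement
of the `A` with `Lᵀ A_L = A_Rᵀ R`; these are the two subspaces of the statement
(`IsCompactSVD.nullSubspace_eq`, `IsCompactSVD.nullComplement_eq`). On the complement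
`‖Dφ A‖² = ‖A_L Rᵀ‖² + ‖L A_Rᵀ‖² + 2 ‖Lᵀ A_L‖²`, which bounds `‖Dφ A‖² / ‖A‖²` from below by
`min(σ_r(L), σ_r(R))²`, while it is at most `2 max(σ₁(L), σ₁(R))²`. The eigenvalue bounds are then
Ostrowski's theorem for a congruence with these singular values
(`LinearMap.IsSymmetric.eigenvalues_mem_uIcc_of_congruence`), proved by the Courant–Fischer
argument.
-/

/-! ### Eigenvalues of symmetric operators under restriction and congruence -/

section Spectral

variable {E F : Type*} [NormedAddCommGroup E] [InnerProductSpace ℝ E]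
  [NormedAddCommGroup F] [InnerProductSpace ℝ F]

lemma OrthonormalBasis.inner_eq_zero_of_mem_span_image {ι : Type*} [Fintype ι]
    (b : OrthonormalBasis ι ℝ E) (s : Set ι) {x : E} (hx : x ∈ Submodule.span ℝ (b '' s))
    {j : ι} (hj : j ∉ s) : ⟪b j, x⟫_ℝ = 0 := by
  induction hx using Submodule.span_induction with
  | mem y hy =>
    obtain ⟨k, hk, rfl⟩ := hy
    exact b.orthonormal.2 (fun h => hj (h ▸ hk))
  | zero => simp
  | add y z _ _ hy hz => rw [inner_add_right, hy, hz, add_zero]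
  | smul a y _ hy => rw [inner_smul_right, hy, mul_zero]

lemma OrthonormalBasis.finrank_span_image {ι : Type*} [Fintype ι]
    (b : OrthonormalBasis ι ℝ E) (s : Finset ι) :
    Module.finrank ℝ (Submodule.span ℝ (b '' (s : Set ι))) = s.card := by
  have := finrank_span_eq_card (R := ℝ) (b := fun i : s => b i)
    (b.orthonormal.linearIndependent.comp _ Subtype.val_injective)
  rw [Fintype.card_coe] at this
  rw [← this, Set.image_eq_range]
  rfl

lemma LinearMap.IsSymmetric.map_mem_orthogonal_of_le_ker {K : E →ₗ[ℝ] E} (hK : K.IsSymmetric)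
    {P : Submodule ℝ E} (hP : P ≤ LinearMap.ker K) : ∀ x ∈ Pᗮ, K x ∈ Pᗮ := by
  intro x _ y hy
  rw [← hK, LinearMap.mem_ker.1 (hP hy), inner_zero_left]

variable [FiniteDimensional ℝ E] [FiniteDimensional ℝ F]

/-- A subspace of dimension larger than the size of `s` contains a nonzero vector whose coordinates
in `s` vanish. -/
lemma OrthonormalBasis.exists_mem_ne_zero_inner_eq_zero {ι : Type*} [Fintype ι]
    (b : OrthonormalBasis ι ℝ E) (W : Submodule ℝ E) (s : Finset ι)
    (hs : s.card < Module.finrank ℝ W) :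
    ∃ x ∈ W, x ≠ 0 ∧ ∀ j ∈ s, ⟪b j, x⟫_ℝ = 0 := by
  let φ : W →ₗ[ℝ] (s → ℝ) := LinearMap.pi fun j => (innerₗ E (b j)).comp W.subtype
  obtain ⟨x, hx, hx0⟩ := (Submodule.ne_bot_iff _).1
    (LinearMap.ker_ne_bot_of_finrank_lt (f := φ) (by simpa using hs))
  refine ⟨x, x.2, by simpa using hx0, fun j hj => ?_⟩
  exact congrFun (LinearMap.mem_ker.1 hx) ⟨j, hj⟩

variable {n : ℕ} {T : E →ₗ[ℝ] E}

lemma LinearMap.IsSymmetric.inner_apply_self_eq_sum (hT : T.IsSymmetric)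
    (hn : Module.finrank ℝ E = n) (x : E) :
    ⟪T x, x⟫_ℝ = ∑ j, hT.eigenvalues hn j * ⟪hT.eigenvectorBasis hn j, x⟫_ℝ ^ 2 := by
  rw [← (hT.eigenvectorBasis hn).sum_inner_mul_inner]
  refine Finset.sum_congr rfl fun j _ => ?_
  rw [hT, hT.apply_eigenvectorBasis, inner_smul_right, real_inner_comm]
  simp only [RCLike.ofReal_real_eq_id, id_eq]
  ring

/-- Courant–Fischer, lower bound; eigenvalues are indexed from `0`, so the subspace needs dimension
at least `i + 1`. -/
lemma LinearMap.IsSymmetric.le_eigenvalues_of_forall_mem (hT : T.IsSymmetric)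
    (hn : Module.finrank ℝ E = n) (W : Submodule ℝ E) (i : Fin n)
    (hW : (i : ℕ) < Module.finrank ℝ W) {c : ℝ} (h : ∀ x ∈ W, c * ‖x‖ ^ 2 ≤ ⟪T x, x⟫_ℝ) :
    c ≤ hT.eigenvalues hn i := by
  obtain ⟨x, hxW, hx0, hx⟩ := (hT.eigenvectorBasis hn).exists_mem_ne_zero_inner_eq_zero W
    (Finset.Iio i) (by simpa using hW)
  have h1 := h x hxW
  have h2 : ⟪T x, x⟫_ℝ ≤ hT.eigenvalues hn i * ‖x‖ ^ 2 := by
    rw [hT.inner_apply_self_eq_sum hn, ← (hT.eigenvectorBasis hn).sum_sq_inner_right x,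
      Finset.mul_sum]
    refine Finset.sum_le_sum fun j _ => ?_
    rcases lt_or_ge j i with hj | hj
    · simp [hx j (Finset.mem_Iio.2 hj)]
    · exact mul_le_mul_of_nonneg_right (hT.eigenvalues_antitone hn hj) (sq_nonneg _)
  exact le_of_mul_le_mul_right (h1.trans h2) (by positivity)

/-- Courant–Fischer, upper bound. -/
lemma LinearMap.IsSymmetric.eigenvalues_le_of_forall_mem (hT : T.IsSymmetric)
    (hn : Module.finrank ℝ E = n) (W : Submodule ℝ E) (i : Fin n)
    (hW : n - 1 - (i : ℕ) < Module.finrank ℝ W) {c : ℝ}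
    (h : ∀ x ∈ W, ⟪T x, x⟫_ℝ ≤ c * ‖x‖ ^ 2) : hT.eigenvalues hn i ≤ c := by
  obtain ⟨x, hxW, hx0, hx⟩ := (hT.eigenvectorBasis hn).exists_mem_ne_zero_inner_eq_zero W
    (Finset.Ioi i) (by simpa using hW)
  have h1 := h x hxW
  have h2 : hT.eigenvalues hn i * ‖x‖ ^ 2 ≤ ⟪T x, x⟫_ℝ := by
    rw [hT.inner_apply_self_eq_sum hn, ← (hT.eigenvectorBasis hn).sum_sq_inner_right x,
      Finset.mul_sum]
    refine Finset.sum_le_sum fun j _ => ?_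
    rcases lt_or_ge i j with hj | hj
    · simp [hx j (Finset.mem_Ioi.2 hj)]
    · exact mul_le_mul_of_nonneg_right (hT.eigenvalues_antitone hn hj) (sq_nonneg _)
  exact le_of_mul_le_mul_right (h2.trans h1) (by positivity)

variable {K : E →ₗ[ℝ] E} {H : F →ₗ[ℝ] F}

/-- Half of Ostrowski's inequality: the form `⟪H y, y⟫` is at least `λᵢ(H) ‖y‖²` on the span of the
eigenvectors with index at most `i`, and this subspace is pulled back along `e`. -/
lemma LinearMap.IsSymmetric.le_eigenvalues_of_congruence (hK : K.IsSymmetric) (hH : H.IsSymmetric)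
    (e : E ≃ₗ[ℝ] F) (hn : Module.finrank ℝ E = n) (hm : Module.finrank ℝ F = n)
    (hq : ∀ x, ⟪K x, x⟫_ℝ = ⟪H (e x), e x⟫_ℝ) (i : Fin n) {c : ℝ}
    (hc : ∀ x, c * ‖x‖ ^ 2 ≤ hH.eigenvalues hm i * ‖e x‖ ^ 2) : c ≤ hK.eigenvalues hn i := by
  set b := hH.eigenvectorBasis hm
  refine hK.le_eigenvalues_of_forall_mem hn
    ((Submodule.span ℝ (b '' (Finset.Iic i : Set (Fin n)))).map (e.symm : F →ₗ[ℝ] E)) i ?_ ?_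
  · rw [LinearEquiv.finrank_map_eq, b.finrank_span_image]
    simp
  · rintro _ ⟨y, hy, rfl⟩
    refine (hc _).trans ?_
    rw [hq]
    simp only [LinearEquiv.coe_coe, LinearEquiv.apply_symm_apply]
    rw [hH.inner_apply_self_eq_sum hm, ← b.sum_sq_inner_right y, Finset.mul_sum]
    refine Finset.sum_le_sum fun j _ => ?_
    rcases lt_or_ge i j with hj | hj
    · have : ⟪b j, y⟫_ℝ = 0 := b.inner_eq_zero_of_mem_span_image _ hy (by simpa using hj)
      simp [b, this]
    · exact mul_le_mul_of_nonneg_right (hH.eigenvalues_antitone hm hj) (sq_nonneg _)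

/-- The other half of Ostrowski's inequality, from the span of the eigenvectors with index at
least `i`. -/
lemma LinearMap.IsSymmetric.eigenvalues_le_of_congruence (hK : K.IsSymmetric) (hH : H.IsSymmetric)
    (e : E ≃ₗ[ℝ] F) (hn : Module.finrank ℝ E = n) (hm : Module.finrank ℝ F = n)
    (hq : ∀ x, ⟪K x, x⟫_ℝ = ⟪H (e x), e x⟫_ℝ) (i : Fin n) {c : ℝ}
    (hc : ∀ x, hH.eigenvalues hm i * ‖e x‖ ^ 2 ≤ c * ‖x‖ ^ 2) : hK.eigenvalues hn i ≤ c := by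
  set b := hH.eigenvectorBasis hm
  refine hK.eigenvalues_le_of_forall_mem hn
    ((Submodule.span ℝ (b '' (Finset.Ici i : Set (Fin n)))).map (e.symm : F →ₗ[ℝ] E)) i ?_ ?_
  · rw [LinearEquiv.finrank_map_eq, b.finrank_span_image]
    simp only [Fin.card_Ici]
    have := i.2
    omega
  · rintro _ ⟨y, hy, rfl⟩
    refine le_trans ?_ (hc _)
    rw [hq]
    simp only [LinearEquiv.coe_coe, LinearEquiv.apply_symm_apply]
    rw [hH.inner_apply_self_eq_sum hm, ← b.sum_sq_inner_right y, Finset.mul_sum]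
    refine Finset.sum_le_sum fun j _ => ?_
    rcases lt_or_ge j i with hj | hj
    · have : ⟪b j, y⟫_ℝ = 0 := b.inner_eq_zero_of_mem_span_image _ hy (by simpa using hj)
      simp [b, this]
    · exact mul_le_mul_of_nonneg_right (hH.eigenvalues_antitone hm hj) (sq_nonneg _)

/-- Ostrowski's theorem: under a congruence `e` whose squared singular values lie in `[α, β]`, each
eigenvalue is multiplied by a factor in `[α, β]`. Which endpoint of the resulting interval is the
larger depends on the sign of the eigenvalue. -/
theorem LinearMap.IsSymmetric.eigenvalues_mem_uIcc_of_congruence (hK : K.IsSymmetric)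
    (hH : H.IsSymmetric) (e : E ≃ₗ[ℝ] F) (hn : Module.finrank ℝ E = n)
    (hm : Module.finrank ℝ F = n) (hq : ∀ x, ⟪K x, x⟫_ℝ = ⟪H (e x), e x⟫_ℝ) {α β : ℝ}
    (hα : ∀ x, α * ‖x‖ ^ 2 ≤ ‖e x‖ ^ 2) (hβ : ∀ x, ‖e x‖ ^ 2 ≤ β * ‖x‖ ^ 2) (i : Fin n) :
    hK.eigenvalues hn i ∈
      Set.uIcc (α * hH.eigenvalues hm i) (β * hH.eigenvalues hm i) := by
  rcases le_total 0 (hH.eigenvalues hm i) with h0 | h0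
  · refine Set.Icc_subset_uIcc ⟨hK.le_eigenvalues_of_congruence hH e hn hm hq i fun x => ?_,
      hK.eigenvalues_le_of_congruence hH e hn hm hq i fun x => ?_⟩
    · rw [mul_comm α, mul_assoc]
      exact mul_le_mul_of_nonneg_left (hα x) h0
    · rw [mul_comm β, mul_assoc]
      exact mul_le_mul_of_nonneg_left (hβ x) h0
  · refine Set.Icc_subset_uIcc' ⟨hK.le_eigenvalues_of_congruence hH e hn hm hq i fun x => ?_,
      hK.eigenvalues_le_of_congruence hH e hn hm hq i fun x => ?_⟩
    · rw [mul_comm β, mul_assoc]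
      exact mul_le_mul_of_nonpos_left (hβ x) h0
    · rw [mul_comm α, mul_assoc]
      exact mul_le_mul_of_nonpos_left (hα x) h0

lemma card_eigenvalueMultiset (hT : T.IsSymmetric) :
    Multiset.card (eigenvalueMultiset T) = Module.finrank ℝ E := by
  simp [eigenvalueMultiset, hT.roots_charpoly_eq_eigenvalues rfl]

lemma kthLargest_eigenvalueMultiset (hT : T.IsSymmetric) (hn : Module.finrank ℝ E = n)
    (i : Fin n) : kthLargest (eigenvalueMultiset T) (i + 1) = hT.eigenvalues hn i := by
  have h := hT.sort_roots_charpoly_eq_eigenvalues hn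
  simp only [RCLike.re_to_real, Multiset.map_id'] at h
  rw [kthLargest, eigenvalueMultiset, h]
  simp

/-- When `K` vanishes on `P`, the decomposition `E = P ⊕ Pᗮ` splits off `dim P` zero
eigenvalues. -/
lemma LinearMap.IsSymmetric.eigenvalueMultiset_eq_replicate_add (hK : K.IsSymmetric)
    {P : Submodule ℝ E} (hP : P ≤ LinearMap.ker K) :
    eigenvalueMultiset K = Multiset.replicate (Module.finrank ℝ P) 0 +
      eigenvalueMultiset (K.restrict (hK.map_mem_orthogonal_of_le_ker hP)) := by
  let e := P.prodEquivOfIsCompl Pᗮ (Submodule.isCompl_orthogonal P)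
  have he : e.symm.conj K =
      LinearMap.prodMap 0 (K.restrict (hK.map_mem_orthogonal_of_le_ker hP)) := by
    refine LinearMap.ext fun x => e.injective ?_
    obtain ⟨x, y⟩ := x
    have hx : K x = 0 := hP x.2
    rw [LinearEquiv.conj_apply_apply, LinearEquiv.apply_symm_apply]
    simp only [e, LinearEquiv.symm_symm, Submodule.coe_prodEquivOfIsCompl', map_add, hx]
    simp
  rw [eigenvalueMultiset, ← e.symm.charpoly_conj, he, LinearMap.charpoly_prodMap,
    Polynomial.roots_mul (mul_ne_zero (LinearMap.charpoly_monic _).ne_zero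
      (LinearMap.charpoly_monic _).ne_zero), LinearMap.charpoly_zero]
  simp [eigenvalueMultiset, Multiset.nsmul_singleton]

end Spectral

/-! ### Singular values as bounds for matrix products -/

section SingularValues

variable {E F : Type*} [NormedAddCommGroup E] [InnerProductSpace ℝ E] [FiniteDimensional ℝ E]
  [NormedAddCommGroup F] [InnerProductSpace ℝ F] [FiniteDimensional ℝ F]

lemma LinearMap.norm_sq_apply_le_singularValues_zero (T : E →ₗ[ℝ] F) (x : E) :
    ‖T x‖ ^ 2 ≤ T.singularValues 0 ^ 2 * ‖x‖ ^ 2 := by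
  have hT := T.isSymmetric_adjoint_comp_self
  have h1 : ‖T x‖ ^ 2 = ⟪(LinearMap.adjoint T ∘ₗ T) x, x⟫_ℝ := by
    rw [LinearMap.comp_apply, LinearMap.adjoint_inner_left, real_inner_self_eq_norm_sq]
  rw [h1, hT.inner_apply_self_eq_sum rfl, ← (hT.eigenvectorBasis rfl).sum_sq_inner_right x,
    Finset.mul_sum]
  refine Finset.sum_le_sum fun j _ => mul_le_mul_of_nonneg_right ?_ (sq_nonneg _)
  rw [← T.sq_singularValues_fin rfl]
  exact pow_le_pow_left₀ (T.singularValues_nonneg _) (T.singularValues_antitone (Nat.zero_le _)) 2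

lemma LinearMap.singularValues_finrank_pred_le_norm_sq_apply (T : E →ₗ[ℝ] F) (x : E) :
    T.singularValues (Module.finrank ℝ E - 1) ^ 2 * ‖x‖ ^ 2 ≤ ‖T x‖ ^ 2 := by
  have hT := T.isSymmetric_adjoint_comp_self
  have h1 : ‖T x‖ ^ 2 = ⟪(LinearMap.adjoint T ∘ₗ T) x, x⟫_ℝ := by
    rw [LinearMap.comp_apply, LinearMap.adjoint_inner_left, real_inner_self_eq_norm_sq]
  rw [h1, hT.inner_apply_self_eq_sum rfl, ← (hT.eigenvectorBasis rfl).sum_sq_inner_right x,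
    Finset.mul_sum]
  refine Finset.sum_le_sum fun j _ => mul_le_mul_of_nonneg_right ?_ (sq_nonneg _)
  rw [← T.sq_singularValues_fin rfl]
  exact pow_le_pow_left₀ (T.singularValues_nonneg _)
    (T.singularValues_antitone (Nat.le_sub_one_of_lt j.2)) 2

lemma inner_matrix_eq_trace {m n : Type*} [Fintype m] [Fintype n] (A B : Matrix m n ℝ) :
    ⟪A, B⟫_ℝ = (Aᵀ * B).trace := rfl

lemma Matrix.norm_sq_eq_sum_norm_sq_row {m n : Type*} [Fintype m] [Fintype n]
    (A : Matrix m n ℝ) : ‖A‖ ^ 2 = ∑ i, ‖WithLp.toLp 2 (A i)‖ ^ 2 := by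
  rw [← real_inner_self_eq_norm_sq, inner_matrix_eq_trace, Matrix.trace_mul_comm]
  simp [Matrix.trace, Matrix.mul_apply, EuclideanSpace.norm_sq_eq, ← sq]

/-- Each row of `B Aᵀ` is the image under `A` of a row of `B`. -/
lemma Matrix.norm_sq_mul_transpose_eq_sum {k m r : ℕ} (A : Matrix (Fin m) (Fin r) ℝ)
    (B : Matrix (Fin k) (Fin r) ℝ) :
    ‖B * Aᵀ‖ ^ 2 = ∑ i, ‖Matrix.toEuclideanLin A (WithLp.toLp 2 (B i))‖ ^ 2 := by
  rw [Matrix.norm_sq_eq_sum_norm_sq_row]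
  refine Finset.sum_congr rfl fun i _ => ?_
  congr 2
  ext j
  simp [Matrix.mul_apply, Matrix.mulVec, dotProduct, mul_comm]

lemma Matrix.norm_sq_mul_transpose_le {k m r : ℕ} (A : Matrix (Fin m) (Fin r) ℝ)
    (B : Matrix (Fin k) (Fin r) ℝ) : ‖B * Aᵀ‖ ^ 2 ≤ matrixSingularValue A 1 ^ 2 * ‖B‖ ^ 2 := by
  rw [Matrix.norm_sq_mul_transpose_eq_sum, Matrix.norm_sq_eq_sum_norm_sq_row B, Finset.mul_sum]
  exact Finset.sum_le_sum fun i _ => LinearMap.norm_sq_apply_le_singularValues_zero _ _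

lemma Matrix.le_norm_sq_mul_transpose {k m r : ℕ} (A : Matrix (Fin m) (Fin r) ℝ)
    (B : Matrix (Fin k) (Fin r) ℝ) : matrixSingularValue A r ^ 2 * ‖B‖ ^ 2 ≤ ‖B * Aᵀ‖ ^ 2 := by
  rw [Matrix.norm_sq_mul_transpose_eq_sum, Matrix.norm_sq_eq_sum_norm_sq_row B, Finset.mul_sum]
  refine Finset.sum_le_sum fun i _ => ?_
  have := (Matrix.toEuclideanLin A).singularValues_finrank_pred_le_norm_sq_apply
    (WithLp.toLp 2 (B i))
  rwa [finrank_euclideanSpace_fin] at this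

lemma matrixSingularValue_nonneg {m n : ℕ} (A : Matrix (Fin m) (Fin n) ℝ) (k : ℕ) :
    0 ≤ matrixSingularValue A k := LinearMap.singularValues_nonneg _ _

end SingularValues

/-! ### Matrices of full column rank -/

section FullRank

variable {m n : Type*} [Fintype m] [Fintype n] {r : ℕ}

lemma Matrix.rank_eq_iff_isUnit_det_transpose_mul_self (A : Matrix m (Fin r) ℝ) :
    A.rank = r ↔ IsUnit (Aᵀ * A).det := by
  rw [← Matrix.rank_transpose_mul_self, ← Matrix.isUnit_iff_isUnit_det]
  constructor
  · intro h
    rw [← Matrix.linearIndependent_cols_iff_isUnit, linearIndependent_iff_card_eq_finrank_span,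
      Fintype.card_fin, Set.finrank, ← Matrix.rank_eq_finrank_span_cols, h]
  · intro h
    simpa using Matrix.rank_of_isUnit _ h

lemma Matrix.rank_mul_transpose_of_rank {L : Matrix m (Fin r) ℝ} {R : Matrix n (Fin r) ℝ}
    (hL : L.rank = r) (hR : R.rank = r) : (L * Rᵀ).rank = r := by
  rw [Matrix.rank_eq_iff_isUnit_det_transpose_mul_self] at hL hR
  refine le_antisymm ((Matrix.rank_mul_le_left _ _).trans (by simpa using L.rank_le_card_width)) ?_
  have h : ((Lᵀ * L) * (Rᵀ * R)).rank = r := by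
    simpa using Matrix.rank_of_isUnit _ (((Matrix.isUnit_iff_isUnit_det _).2 hL).mul
      ((Matrix.isUnit_iff_isUnit_det _).2 hR))
  rw [show (Lᵀ * L) * (Rᵀ * R) = Lᵀ * ((L * Rᵀ) * R) by simp only [Matrix.mul_assoc]] at h
  exact h.symm.le.trans <| (Matrix.rank_mul_le_right _ _).trans (Matrix.rank_mul_le_left _ _)

lemma Matrix.inv_gram_mul_gram {A : Matrix m (Fin r) ℝ} (hA : A.rank = r) :
    (Aᵀ * A)⁻¹ * (Aᵀ * A) = 1 :=
  Matrix.nonsing_inv_mul _ ((Matrix.rank_eq_iff_isUnit_det_transpose_mul_self A).1 hA)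

lemma Matrix.gram_mul_inv_gram {A : Matrix m (Fin r) ℝ} (hA : A.rank = r) :
    (Aᵀ * A) * (Aᵀ * A)⁻¹ = 1 :=
  Matrix.mul_nonsing_inv _ ((Matrix.rank_eq_iff_isUnit_det_transpose_mul_self A).1 hA)

lemma Matrix.transpose_inv_gram (A : Matrix m (Fin r) ℝ) :
    ((Aᵀ * A)⁻¹)ᵀ = (Aᵀ * A)⁻¹ := by
  rw [Matrix.transpose_nonsing_inv, Matrix.transpose_mul, Matrix.transpose_transpose]

/-- The orthogonal projection onto the column space of a matrix of full column rank. -/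
noncomputable def columnProjection (A : Matrix m (Fin r) ℝ) : Matrix m m ℝ := A * (Aᵀ * A)⁻¹ * Aᵀ

lemma transpose_columnProjection (A : Matrix m (Fin r) ℝ) :
    (columnProjection A)ᵀ = columnProjection A := by
  simp only [columnProjection, Matrix.transpose_mul, Matrix.transpose_transpose,
    Matrix.transpose_inv_gram, Matrix.mul_assoc]

lemma columnProjection_mul {A : Matrix m (Fin r) ℝ} (hA : A.rank = r) :
    columnProjection A * A = A := by
  rw [columnProjection, Matrix.mul_assoc, Matrix.mul_assoc, Matrix.inv_gram_mul_gram hA,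
    Matrix.mul_one]

lemma transpose_mul_columnProjection {A : Matrix m (Fin r) ℝ} (hA : A.rank = r) :
    Aᵀ * columnProjection A = Aᵀ := by
  rw [← transpose_columnProjection, ← Matrix.transpose_mul, columnProjection_mul hA]

end FullRank

/-! ### The Moore–Penrose inverse of a matrix of full column rank -/

section MoorePenrose

variable {m n r : ℕ}

lemma IsMoorePenroseInverse.unique {A : Matrix (Fin m) (Fin n) ℝ} {B C : Matrix (Fin n) (Fin m) ℝ}
    (hB : IsMoorePenroseInverse A B) (hC : IsMoorePenroseInverse A C) : B = C := by
  have h1 : A * B = A * C := by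
    calc A * B = (A * C) * (A * B) := by rw [← Matrix.mul_assoc, hC.mul_mul_left]
      _ = (A * C)ᵀ * (A * B)ᵀ := by rw [hC.symm_left, hB.symm_left]
      _ = ((A * B * A) * C)ᵀ := by rw [← Matrix.transpose_mul, ← Matrix.mul_assoc]
      _ = A * C := by rw [hB.mul_mul_left, hC.symm_left]
  have h2 : B * A = C * A := by
    calc B * A = (B * A) * (C * A) := by
          rw [Matrix.mul_assoc, ← Matrix.mul_assoc A, hC.mul_mul_left]
      _ = (B * A)ᵀ * (C * A)ᵀ := by rw [hC.symm_right, hB.symm_right]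
      _ = (C * (A * B * A))ᵀ := by rw [← Matrix.transpose_mul]; simp only [Matrix.mul_assoc]
      _ = C * A := by rw [hB.mul_mul_left, hC.symm_right]
  rw [← hB.mul_mul_right, h2, Matrix.mul_assoc, h1, ← Matrix.mul_assoc, hC.mul_mul_right]

lemma moorePenrose_of_rank {A : Matrix (Fin m) (Fin r) ℝ} (hA : A.rank = r) :
    moorePenrose A = (Aᵀ * A)⁻¹ * Aᵀ := by
  have h : IsMoorePenroseInverse A ((Aᵀ * A)⁻¹ * Aᵀ) := by
    have h1 : (Aᵀ * A)⁻¹ * Aᵀ * A = 1 := by rw [Matrix.mul_assoc, Matrix.inv_gram_mul_gram hA]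
    refine ⟨by rw [Matrix.mul_assoc, h1, Matrix.mul_one], by rw [h1, Matrix.one_mul], ?_,
      by rw [h1, Matrix.transpose_one]⟩
    rw [← Matrix.mul_assoc]
    exact transpose_columnProjection A
  have hex : ∃ B, IsMoorePenroseInverse A B := ⟨_, h⟩
  rw [moorePenrose, dif_pos hex]
  exact hex.choose_spec.unique h

end MoorePenrose

/-! ### Second-order chain rule for maps into an embedded set -/

section EmbeddedCalculus

lemma hasDerivAt_line {E : Type*} [NormedAddCommGroup E] [NormedSpace ℝ E] (x v : E) :
    HasDerivAt (fun t : ℝ => x + t • v) v 0 := by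
  simpa using ((hasDerivAt_id (0 : ℝ)).smul_const v).const_add x

variable {E W : Type*} [NormedAddCommGroup E] [InnerProductSpace ℝ E]
  [NormedAddCommGroup W] [InnerProductSpace ℝ W]
  {M : Set E} {F : E → ℝ} {x : E} {φ : W → E} {w : W}

/-- Velocities at `w` of a smooth map that stays in `M` near `w` are tangent to `M`. -/
lemma fderiv_mem_tangentSpaceAt (hφ : ContDiff ℝ ∞ φ) (hM : ∀ᶠ v in 𝓝 w, φ v ∈ M) (B : W) :
    fderiv ℝ φ w B ∈ tangentSpaceAt M (φ w) := by
  have hc : ContDiff ℝ ∞ fun t : ℝ => w + t • B := by fun_prop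
  have h0 : w + (0 : ℝ) • B = w := by simp
  refine Submodule.subset_span ⟨fun t => φ (w + t • B), hφ.comp hc, by simp, ?_, ?_⟩
  · exact (hc.continuous.tendsto' 0 w h0).eventually hM
  · have h1 : HasDerivAt (fun t : ℝ => w + t • B) B 0 := hasDerivAt_line w B
    have h2 : HasFDerivAt φ (fderiv ℝ φ w) (w + (0 : ℝ) • B) := by
      rw [h0]
      exact (hφ.differentiable (by simp) w).hasFDerivAt
    exact h2.comp_hasDerivAt 0 h1


variable [FiniteDimensional ℝ E] [FiniteDimensional ℝ W]

lemma inner_riemannianGradient {Z : E} (hZ : Z ∈ tangentSpaceAt M x) :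
    ⟪(riemannianGradient M F x : E), Z⟫_ℝ = fderiv ℝ F x Z := by
  have : CompleteSpace (tangentSpaceAt M x) := FiniteDimensional.complete ℝ _
  have h := InnerProductSpace.toDual_symm_apply (𝕜 := ℝ) (E := tangentSpaceAt M x)
    (x := ⟨Z, hZ⟩) (y := (fderiv ℝ F x).comp (tangentSpaceAt M x).subtypeL)
  exact h

lemma riemannianGradient_eq_of_inner {G : E} (hG : G ∈ tangentSpaceAt M x)
    (h : ∀ Z ∈ tangentSpaceAt M x, ⟪G, Z⟫_ℝ = fderiv ℝ F x Z) :
    (riemannianGradient M F x : E) = G := by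
  rw [← sub_eq_zero, ← inner_self_eq_zero (𝕜 := ℝ)]
  have hm := (tangentSpaceAt M x).sub_mem (riemannianGradient M F x).2 hG
  rw [inner_sub_left, inner_riemannianGradient hm, h _ hm, sub_self]

/-- Against tangent vectors the orthogonal projection in the covariant derivative drops out. -/
lemma inner_riemannianHessian (Z Z' : tangentSpaceAt M x) :
    ⟪riemannianHessian M F x Z, Z'⟫_ℝ =
      ⟪fderivWithin ℝ (fun y : E => (riemannianGradient M F y : E)) M x Z, (Z' : E)⟫_ℝ := by
  exact Submodule.inner_orthogonalProjectionOnto_eq_of_mem_right Z' _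

lemma inner_euclideanHessian (hF : ContDiff ℝ 2 F) (x A B : E) :
    ⟪euclideanHessian F x A, B⟫_ℝ = fderiv ℝ (fderiv ℝ F) x A B := by
  have : CompleteSpace E := FiniteDimensional.complete ℝ E
  have h1 : DifferentiableAt ℝ (fderiv ℝ F) x :=
    ((hF.fderiv_right (m := 1) (by norm_num)).differentiable (by norm_num)) x
  have h2 : HasFDerivAt (fun y => gradient F y) _ x :=
    (InnerProductSpace.toDual ℝ E).symm.toContinuousLinearEquiv.hasFDerivAt.comp x h1.hasFDerivAt
  have h3 : euclideanHessian F x A =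
      (InnerProductSpace.toDual ℝ E).symm (fderiv ℝ (fderiv ℝ F) x A) := by
    simp only [euclideanHessian]
    rw [h2.fderiv]
    rfl
  rw [h3, InnerProductSpace.toDual_symm_apply]

lemma euclideanHessian_isSymmetric (hF : ContDiff ℝ 2 F) (x : E) :
    (euclideanHessian F x).IsSymmetric := by
  intro A B
  refine Eq.trans ?_ (real_inner_comm _ _)
  rw [inner_euclideanHessian hF, inner_euclideanHessian hF]
  exact hF.contDiffAt.isSymmSndFDerivAt (by simp) |>.eq A B

lemma differentiable_gradient (hF : ContDiff ℝ 2 F) :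
    haveI : CompleteSpace E := FiniteDimensional.complete ℝ E
    Differentiable ℝ (fun y => gradient F y) := by
  have : CompleteSpace E := FiniteDimensional.complete ℝ E
  exact (InnerProductSpace.toDual ℝ E).symm.toContinuousLinearEquiv.differentiable.comp
    ((hF.fderiv_right (m := 1) (by norm_num)).differentiable (by norm_num))

/-- Second-order chain rule for a map `φ` into `M`: differentiate the identity
`D(F ∘ φ)(v)[B] = ⟪grad F (φ v), Dφ(v)[B]⟫`, valid near `w` because `Dφ(v)[B]` is tangent. -/
theorem inner_euclideanHessian_comp (hφ : ContDiff ℝ ∞ φ) (hF : ContDiff ℝ 2 F)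
    (hM : ∀ᶠ v in 𝓝 w, φ v ∈ M)
    (hG : DifferentiableWithinAt ℝ (fun y : E => (riemannianGradient M F y : E)) M (φ w))
    (A B : W) :
    ⟪euclideanHessian (fun v => F (φ v)) w A, B⟫_ℝ =
      ⟪riemannianHessian M F (φ w) ⟨fderiv ℝ φ w A, fderiv_mem_tangentSpaceAt hφ hM A⟩,
        ⟨fderiv ℝ φ w B, fderiv_mem_tangentSpaceAt hφ hM B⟩⟫_ℝ +
      ⟪(riemannianGradient M F (φ w) : E), fderiv ℝ (fderiv ℝ φ) w A B⟫_ℝ := by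
  have hφ2 : ContDiff ℝ 2 φ := contDiff_infty.1 hφ 2
  have hg : ContDiff ℝ 2 fun v => F (φ v) := hF.comp hφ2
  rw [inner_euclideanHessian hg, inner_riemannianHessian]
  have hdφ : DifferentiableAt ℝ (fderiv ℝ φ) w :=
    ((hφ2.fderiv_right (m := 1) (by norm_num)).differentiable (by norm_num)) w
  have hdg : DifferentiableAt ℝ (fderiv ℝ fun v => F (φ v)) w :=
    ((hg.fderiv_right (m := 1) (by norm_num)).differentiable (by norm_num)) w
  have hev : (fun v => fderiv ℝ (fun v => F (φ v)) v B) =ᶠ[𝓝 w]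
      fun v => ⟪(riemannianGradient M F (φ v) : E), fderiv ℝ φ v B⟫_ℝ := by
    filter_upwards [hM.eventually_nhds] with v hv
    rw [inner_riemannianGradient (fderiv_mem_tangentSpaceAt hφ hv B)]
    have : HasFDerivAt (fun v => F (φ v)) _ v :=
      (hF.differentiable (by norm_num) (φ v)).hasFDerivAt.comp v
        (hφ.differentiable (by simp) v).hasFDerivAt
    rw [this.fderiv]
    rfl
  have h1 : HasFDerivAt (fun v => (riemannianGradient M F (φ v) : E))
      ((fderivWithin ℝ (fun y : E => (riemannianGradient M F y : E)) M (φ w)).comp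
        (fderiv ℝ φ w)) w := by
    exact hG.hasFDerivWithinAt.comp_hasFDerivAt w (hφ.differentiable (by simp) w).hasFDerivAt hM
  have h2 : HasFDerivAt (fun v => fderiv ℝ φ v B) ((fderiv ℝ (fderiv ℝ φ) w).flip B) w :=
    ((ContinuousLinearMap.apply ℝ E B).hasFDerivAt.comp w hdφ.hasFDerivAt :)
  have h3 : HasFDerivAt (fun v => fderiv ℝ (fun v => F (φ v)) v B)
      ((fderiv ℝ (fderiv ℝ fun v => F (φ v)) w).flip B) w :=
    ((ContinuousLinearMap.apply ℝ ℝ B).hasFDerivAt.comp w hdg.hasFDerivAt :)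
  have h4 := (h3.unique ((h1.inner ℝ h2).congr_of_eventuallyEq hev))
  have h5 := DFunLike.congr_fun h4 A
  simp only [ContinuousLinearMap.flip_apply, ContinuousLinearMap.comp_apply,
    ContinuousLinearMap.prod_apply, fderivInnerCLM_apply] at h5
  rw [h5, add_comm]

end EmbeddedCalculus

/-! ### Differentiability of matrix operations -/

section MatrixCalculus

variable {l m n : Type*} [Fintype l] [Fintype m] [Fintype n]
  {E : Type*} [NormedAddCommGroup E] [NormedSpace ℝ E]

lemma Matrix.isBoundedBilinearMap_mul :
    IsBoundedBilinearMap ℝ fun p : Matrix l m ℝ × Matrix m n ℝ => p.1 * p.2 where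
  add_left := Matrix.add_mul
  smul_left := Matrix.smul_mul
  add_right := Matrix.mul_add
  smul_right c A B := Matrix.mul_smul A c B
  bound := ⟨1, one_pos, fun A B => by rw [one_mul]; exact Matrix.frobenius_norm_mul A B⟩

lemma ContDiff.matrix_mul {k : ℕ∞ω} {A : E → Matrix l m ℝ} {B : E → Matrix m n ℝ}
    (hA : ContDiff ℝ k A) (hB : ContDiff ℝ k B) : ContDiff ℝ k fun x => A x * B x :=
  (Matrix.isBoundedBilinearMap_mul (l := l) (m := m) (n := n)).contDiff.comp (hA.prodMk hB)

lemma DifferentiableAt.matrix_mul {A : E → Matrix l m ℝ} {B : E → Matrix m n ℝ} {x : E}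
    (hA : DifferentiableAt ℝ A x) (hB : DifferentiableAt ℝ B x) :
    DifferentiableAt ℝ (fun x => A x * B x) x :=
  DifferentiableAt.comp (g := fun p : Matrix l m ℝ × Matrix m n ℝ => p.1 * p.2) x
    (Matrix.isBoundedBilinearMap_mul.differentiableAt (A x, B x)) (hA.prodMk hB)

lemma IsBoundedBilinearMap.hasDerivAt_comp {E₁ E₂ E₃ : Type*} [NormedAddCommGroup E₁]
    [NormedSpace ℝ E₁] [NormedAddCommGroup E₂] [NormedSpace ℝ E₂] [NormedAddCommGroup E₃]
    [NormedSpace ℝ E₃] {b : E₁ × E₂ → E₃} (hb : IsBoundedBilinearMap ℝ b) {f : ℝ → E₁}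
    {g : ℝ → E₂} {f' : E₁} {g' : E₂} {t : ℝ} (hf : HasDerivAt f f' t) (hg : HasDerivAt g g' t) :
    HasDerivAt (fun t => b (f t, g t)) (b (f t, g') + b (f', g t)) t :=
  HasFDerivAt.comp_hasDerivAt (l := b) (l' := hb.deriv (f t, g t)) t
    (hb.hasFDerivAt (f t, g t)) (hf.prodMk hg)

lemma HasDerivAt.matrix_mul {A : ℝ → Matrix l m ℝ} {B : ℝ → Matrix m n ℝ}
    {A' : Matrix l m ℝ} {B' : Matrix m n ℝ} {t : ℝ}
    (hA : HasDerivAt A A' t) (hB : HasDerivAt B B' t) :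
    HasDerivAt (fun t => A t * B t) (A t * B' + A' * B t) t :=
  (Matrix.isBoundedBilinearMap_mul (l := l) (m := m) (n := n)).hasDerivAt_comp hA hB

/-- Transposition as a continuous linear map. -/
noncomputable def Matrix.transposeL (m n : Type*) [Fintype m] [Fintype n] :
    Matrix m n ℝ →L[ℝ] Matrix n m ℝ :=
  LinearMap.toContinuousLinearMap (Matrix.transposeLinearEquiv m n ℝ ℝ).toLinearMap

lemma DifferentiableAt.matrix_transpose {A : E → Matrix l m ℝ} {x : E}
    (hA : DifferentiableAt ℝ A x) : DifferentiableAt ℝ (fun x => (A x)ᵀ) x :=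
  (Matrix.transposeL l m).differentiableAt.comp x hA

lemma DifferentiableAt.matrix_inv [DecidableEq m] {A : E → Matrix m m ℝ} {x : E}
    (hA : DifferentiableAt ℝ A x) (hx : IsUnit (A x).det) :
    DifferentiableAt ℝ (fun x => (A x)⁻¹) x := by
  have : HasSummableGeomSeries (Matrix m m ℝ) := inferInstance
  simp only [Matrix.nonsing_inv_eq_ringInverse]
  exact DifferentiableAt.inverse hA ((Matrix.isUnit_iff_isUnit_det _).2 hx)

variable {r : ℕ}

lemma DifferentiableAt.inv_gram {A : E → Matrix m (Fin r) ℝ} {x : E}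
    (hA : DifferentiableAt ℝ A x) (hx : (A x).rank = r) :
    DifferentiableAt ℝ (fun x => ((A x)ᵀ * A x)⁻¹) x :=
  (hA.matrix_transpose.matrix_mul hA).matrix_inv
    ((Matrix.rank_eq_iff_isUnit_det_transpose_mul_self _).1 hx)

lemma DifferentiableAt.columnProjection {A : E → Matrix m (Fin r) ℝ} {x : E}
    (hA : DifferentiableAt ℝ A x) (hx : (A x).rank = r) :
    DifferentiableAt ℝ (fun x => columnProjection (A x)) x :=
  (hA.matrix_mul (hA.inv_gram hx)).matrix_mul hA.matrix_transpose

/-- Full column rank is an open condition. -/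
lemma ContinuousAt.eventually_rank_eq {X : Type*} [TopologicalSpace X]
    {A : X → Matrix m (Fin r) ℝ} {x : X} (hA : ContinuousAt A x) (hx : (A x).rank = r) :
    ∀ᶠ y in 𝓝 x, (A y).rank = r := by
  simp only [Matrix.rank_eq_iff_isUnit_det_transpose_mul_self, isUnit_iff_ne_zero] at hx ⊢
  have hc : Continuous fun B : Matrix m (Fin r) ℝ => (Bᵀ * B).det :=
    (continuous_id.matrix_transpose.matrix_mul continuous_id).matrix_det
  exact (hc.continuousAt.comp hA).eventually_ne hx

end MatrixCalculus

/-! ### The tangent space of the matrices of fixed rank -/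

section Factorization

variable {p₁ p₂ r : ℕ}

/-- The product `L Rᵀ` of the two blocks of a stacked matrix `[Lᵀ Rᵀ]ᵀ`. -/
def factorProduct (W : Matrix (Fin p₁ ⊕ Fin p₂) (Fin r) ℝ) : Matrix (Fin p₁) (Fin p₂) ℝ :=
  W.toRows₁ * W.toRows₂ᵀ

/-- The derivative `A ↦ A_L Rᵀ + L A_Rᵀ` at `(L, R)` of the product `L Rᵀ`. -/
def factorDeriv (L : Matrix (Fin p₁) (Fin r) ℝ) (R : Matrix (Fin p₂) (Fin r) ℝ) :
    Matrix (Fin p₁ ⊕ Fin p₂) (Fin r) ℝ →ₗ[ℝ] Matrix (Fin p₁) (Fin p₂) ℝ where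
  toFun A := A.toRows₁ * Rᵀ + L * A.toRows₂ᵀ
  map_add' A B := by
    have h1 : (A + B).toRows₁ = A.toRows₁ + B.toRows₁ := rfl
    have h2 : (A + B).toRows₂ = A.toRows₂ + B.toRows₂ := rfl
    rw [h1, h2, Matrix.transpose_add, Matrix.add_mul, Matrix.mul_add]
    abel
  map_smul' c A := by
    have h1 : (c • A).toRows₁ = c • A.toRows₁ := rfl
    have h2 : (c • A).toRows₂ = c • A.toRows₂ := rfl
    rw [h1, h2, Matrix.transpose_smul, Matrix.smul_mul, Matrix.mul_smul, RingHom.id_apply, smul_add]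

variable {L : Matrix (Fin p₁) (Fin r) ℝ} {R : Matrix (Fin p₂) (Fin r) ℝ}

lemma factorDeriv_apply (A : Matrix (Fin p₁ ⊕ Fin p₂) (Fin r) ℝ) :
    factorDeriv L R A = A.toRows₁ * Rᵀ + L * A.toRows₂ᵀ := rfl

lemma contDiff_toRows₁ {k : ℕ∞ω} :
    ContDiff ℝ k fun W : Matrix (Fin p₁ ⊕ Fin p₂) (Fin r) ℝ => W.toRows₁ :=
  (LinearMap.toContinuousLinearMap (𝕜 := ℝ) (E := Matrix (Fin p₁ ⊕ Fin p₂) (Fin r) ℝ)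
    (F' := Matrix (Fin p₁) (Fin r) ℝ)
    { toFun := fun W => W.toRows₁, map_add' := fun _ _ => rfl,
      map_smul' := fun _ _ => rfl }).contDiff

lemma contDiff_transpose_toRows₂ {k : ℕ∞ω} :
    ContDiff ℝ k fun W : Matrix (Fin p₁ ⊕ Fin p₂) (Fin r) ℝ => W.toRows₂ᵀ :=
  (LinearMap.toContinuousLinearMap (𝕜 := ℝ) (E := Matrix (Fin p₁ ⊕ Fin p₂) (Fin r) ℝ)
    (F' := Matrix (Fin r) (Fin p₂) ℝ)
    { toFun := fun W => W.toRows₂ᵀ, map_add' := fun _ _ => rfl,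
      map_smul' := fun _ _ => rfl }).contDiff

lemma contDiff_factorProduct {k : ℕ∞ω} :
    ContDiff ℝ k (factorProduct (p₁ := p₁) (p₂ := p₂) (r := r)) :=
  contDiff_toRows₁.matrix_mul contDiff_transpose_toRows₂

/-- Computed along the line `t ↦ (L + t A_L, R + t A_R)`. -/
lemma fderiv_factorProduct (A : Matrix (Fin p₁ ⊕ Fin p₂) (Fin r) ℝ) :
    fderiv ℝ factorProduct (Matrix.fromRows L R) A = factorDeriv L R A := by
  have h1 : HasDerivAt (fun t : ℝ => (L + t • A.toRows₁) * (Rᵀ + t • A.toRows₂ᵀ))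
      ((L + (0 : ℝ) • A.toRows₁) * A.toRows₂ᵀ + A.toRows₁ * (Rᵀ + (0 : ℝ) • A.toRows₂ᵀ)) 0 :=
    (hasDerivAt_line L A.toRows₁).matrix_mul (hasDerivAt_line Rᵀ A.toRows₂ᵀ)
  have h2 : HasDerivAt (fun t : ℝ => factorProduct (Matrix.fromRows L R + t • A))
      (fderiv ℝ factorProduct (Matrix.fromRows L R) A) 0 := by
    refine HasFDerivAt.comp_hasDerivAt (l := factorProduct)
      (l' := fderiv ℝ factorProduct (Matrix.fromRows L R)) 0 ?_ (hasDerivAt_line _ A)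
    rw [zero_smul, add_zero]
    exact (contDiff_factorProduct.differentiable one_ne_zero _).hasFDerivAt
  rw [h2.unique h1, factorDeriv_apply, zero_smul, zero_smul, add_zero, add_zero, add_comm]

lemma eventually_factorProduct_mem_fixedRank (hL : L.rank = r) (hR : R.rank = r) :
    ∀ᶠ W in 𝓝 (Matrix.fromRows L R), factorProduct W ∈ fixedRank p₁ p₂ r := by
  have h1 := (contDiff_toRows₁ (p₁ := p₁) (p₂ := p₂) (r := r)
    (k := 0)).continuous.continuousAt.eventually_rank_eq (x := Matrix.fromRows L R) hL
  have h2 := (contDiff_transpose_toRows₂ (p₁ := p₁) (p₂ := p₂) (r := r)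
    (k := 0)).continuous.matrix_transpose.continuousAt.eventually_rank_eq
      (x := Matrix.fromRows L R) hR
  filter_upwards [h1, h2] with W hW₁ hW₂
  exact Matrix.rank_mul_transpose_of_rank hW₁ hW₂

/-- If `A K` has the same rank as `A`, both have the same column space. -/
lemma columnProjection_mul_of_rank_mul {A : Matrix (Fin p₁) (Fin p₂) ℝ}
    {K : Matrix (Fin p₂) (Fin r) ℝ} (hA : A.rank = r) (hAK : (A * K).rank = r) :
    columnProjection (A * K) * A = A := by
  have hle : LinearMap.range (A * K).mulVecLin ≤ LinearMap.range A.mulVecLin := by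
    rw [Matrix.mulVecLin_mul]
    exact LinearMap.range_comp_le_range _ _
  have heq := Submodule.eq_of_le_of_finrank_eq hle (hAK.trans hA.symm)
  refine Matrix.ext_of_mulVec_single fun j => ?_
  obtain ⟨w, hw⟩ : A.mulVecLin (Pi.single j 1) ∈ LinearMap.range (A * K).mulVecLin :=
    heq ▸ LinearMap.mem_range_self _ _
  simp only [Matrix.mulVecLin_apply] at hw
  rw [← Matrix.mulVec_mulVec, ← hw, Matrix.mulVec_mulVec, columnProjection_mul hAK]

/-- Left factor of the local smooth section `Y ↦ (Y R (RᵀR)⁻¹, ·)` of `(L, R) ↦ L Rᵀ`. -/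
noncomputable def sectionLeft (R : Matrix (Fin p₂) (Fin r) ℝ) (Y : Matrix (Fin p₁) (Fin p₂) ℝ) :
    Matrix (Fin p₁) (Fin r) ℝ :=
  Y * (R * (Rᵀ * R)⁻¹)

/-- Right factor, transposed, of the local smooth section of `(L, R) ↦ L Rᵀ`: with
`K = sectionLeft R Y` it is `(KᵀK)⁻¹ Kᵀ Y`, so that `K` times it projects `Y` onto the column space
of `K`. -/
noncomputable def sectionRight (R : Matrix (Fin p₂) (Fin r) ℝ) (Y : Matrix (Fin p₁) (Fin p₂) ℝ) :
    Matrix (Fin r) (Fin p₂) ℝ :=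
  ((sectionLeft R Y)ᵀ * sectionLeft R Y)⁻¹ * (sectionLeft R Y)ᵀ * Y

lemma sectionLeft_mul_transpose (hR : R.rank = r) : sectionLeft R (L * Rᵀ) = L := by
  rw [sectionLeft, Matrix.mul_assoc, ← Matrix.mul_assoc Rᵀ, Matrix.gram_mul_inv_gram hR,
    Matrix.mul_one]

lemma sectionRight_mul_transpose (hL : L.rank = r) (hR : R.rank = r) :
    sectionRight R (L * Rᵀ) = Rᵀ := by
  rw [sectionRight, sectionLeft_mul_transpose hR, Matrix.mul_assoc, ← Matrix.mul_assoc Lᵀ,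
    ← Matrix.mul_assoc, Matrix.inv_gram_mul_gram hL, Matrix.one_mul]

lemma sectionLeft_mul_sectionRight {Y : Matrix (Fin p₁) (Fin p₂) ℝ} (hY : Y.rank = r)
    (hK : (sectionLeft R Y).rank = r) : sectionLeft R Y * sectionRight R Y = Y := by
  rw [sectionRight, ← Matrix.mul_assoc, ← Matrix.mul_assoc]
  exact columnProjection_mul_of_rank_mul hY hK

lemma rank_transpose_sectionRight {Y : Matrix (Fin p₁) (Fin p₂) ℝ} (hY : Y.rank = r)
    (hK : (sectionLeft R Y).rank = r) : (sectionRight R Y)ᵀ.rank = r := by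
  refine le_antisymm (by simpa using (sectionRight R Y)ᵀ.rank_le_card_width) ?_
  rw [Matrix.rank_transpose]
  have h := Matrix.rank_mul_le_right (sectionLeft R Y) (sectionRight R Y)
  rwa [sectionLeft_mul_sectionRight hY hK, hY] at h

lemma differentiable_sectionLeft : Differentiable ℝ (sectionLeft (p₁ := p₁) R) := fun _ =>
  differentiableAt_id.matrix_mul (differentiableAt_const _)

lemma differentiableAt_sectionRight {Y : Matrix (Fin p₁) (Fin p₂) ℝ}
    (hK : (sectionLeft R Y).rank = r) : DifferentiableAt ℝ (sectionRight (p₁ := p₁) R) Y :=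
  (((differentiable_sectionLeft Y).inv_gram hK).matrix_mul
    (differentiable_sectionLeft Y).matrix_transpose).matrix_mul differentiableAt_id

/-- The tangent space of the matrices of rank `r` is `{A Rᵀ + L Bᵀ}`: a curve of rank `r` matrices
lifts through the local section, so its velocity is a value of the derivative of `L Rᵀ`. -/
theorem tangentSpaceAt_fixedRank (hL : L.rank = r) (hR : R.rank = r) :
    tangentSpaceAt (fixedRank p₁ p₂ r) (L * Rᵀ) = LinearMap.range (factorDeriv L R) := by
  refine le_antisymm (Submodule.span_le.2 ?_) ?_
  · rintro v ⟨γ, -, h0, hM, hv⟩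
    have hcont : ContinuousAt (fun t => sectionLeft R (γ t)) 0 :=
      differentiable_sectionLeft.continuous.continuousAt.comp hv.continuousAt
    have hK0 : (sectionLeft R (γ 0)).rank = r := by rw [h0, sectionLeft_mul_transpose hR, hL]
    have hK := hcont.eventually_rank_eq hK0
    have h1 : HasDerivAt (fun t => sectionLeft R (γ t)) _ 0 :=
      ((differentiable_sectionLeft (γ 0)).comp 0 hv.differentiableAt).hasDerivAt
    have h2 : HasDerivAt (fun t => sectionRight R (γ t)) _ 0 :=
      ((differentiableAt_sectionRight hK0).comp 0 hv.differentiableAt).hasDerivAt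
    have h3 := (h1.matrix_mul h2).congr_of_eventuallyEq (f₁ := γ) (by
      filter_upwards [hM, hK] with t ht hKt
      exact (sectionLeft_mul_sectionRight ht hKt).symm)
    rw [h0, sectionLeft_mul_transpose hR, sectionRight_mul_transpose hL hR] at h3
    refine ⟨Matrix.fromRows (deriv (sectionLeft R ∘ γ) 0) (deriv (sectionRight R ∘ γ) 0)ᵀ, ?_⟩
    rw [hv.unique h3, factorDeriv_apply, Matrix.toRows₁_fromRows, Matrix.toRows₂_fromRows,
      Matrix.transpose_transpose, add_comm]
    rfl
  · rintro _ ⟨A, rfl⟩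
    rw [← fderiv_factorProduct]
    exact fderiv_mem_tangentSpaceAt contDiff_factorProduct
      (eventually_factorProduct_mem_fixedRank hL hR) A

end Factorization

/-! ### The Frobenius inner product -/

section FrobeniusInner

variable {l m n : Type*} [Fintype l] [Fintype m] [Fintype n]

lemma inner_matrix_mul_left (X : Matrix l n ℝ) (A : Matrix l m ℝ) (B : Matrix m n ℝ) :
    ⟪X, A * B⟫_ℝ = ⟪Aᵀ * X, B⟫_ℝ := by
  rw [inner_matrix_eq_trace, inner_matrix_eq_trace, Matrix.transpose_mul,
    Matrix.transpose_transpose, Matrix.mul_assoc]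

lemma inner_matrix_mul_right (X : Matrix l n ℝ) (A : Matrix l m ℝ) (B : Matrix m n ℝ) :
    ⟪X, A * B⟫_ℝ = ⟪X * Bᵀ, A⟫_ℝ := by
  rw [inner_matrix_eq_trace, inner_matrix_eq_trace, Matrix.transpose_mul,
    Matrix.transpose_transpose, ← Matrix.mul_assoc, Matrix.trace_mul_comm, Matrix.mul_assoc]

lemma inner_matrix_transpose (X Y : Matrix m n ℝ) : ⟪Xᵀ, Yᵀ⟫_ℝ = ⟪X, Y⟫_ℝ := by
  rw [inner_matrix_eq_trace, inner_matrix_eq_trace, ← Matrix.trace_transpose,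
    Matrix.transpose_mul, Matrix.transpose_transpose, Matrix.transpose_transpose,
    Matrix.trace_mul_comm]

lemma inner_matrix_stacked (A B : Matrix (l ⊕ m) n ℝ) :
    ⟪A, B⟫_ℝ = ⟪A.toRows₁, B.toRows₁⟫_ℝ + ⟪A.toRows₂, B.toRows₂⟫_ℝ := by
  simp only [inner_matrix_eq_trace]
  rw [← Matrix.trace_add, ← Matrix.fromCols_mul_fromRows, ← Matrix.transpose_fromRows,
    Matrix.fromRows_toRows, Matrix.fromRows_toRows]

lemma norm_sq_matrix_stacked (A : Matrix (l ⊕ m) n ℝ) :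
    ‖A‖ ^ 2 = ‖A.toRows₁‖ ^ 2 + ‖A.toRows₂‖ ^ 2 := by
  simp only [← real_inner_self_eq_norm_sq]
  exact inner_matrix_stacked A A

end FrobeniusInner

/-! ### The kernel of the derivative of the product and norm bounds -/

section FactorizationKernel

variable {p₁ p₂ r : ℕ} {L : Matrix (Fin p₁) (Fin r) ℝ} {R : Matrix (Fin p₂) (Fin r) ℝ}

lemma inner_factorDeriv (X : Matrix (Fin p₁) (Fin p₂) ℝ)
    (A : Matrix (Fin p₁ ⊕ Fin p₂) (Fin r) ℝ) :
    ⟪X, factorDeriv L R A⟫_ℝ = ⟪X * R, A.toRows₁⟫_ℝ + ⟪Xᵀ * L, A.toRows₂⟫_ℝ := by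
  rw [factorDeriv_apply, inner_add_right, inner_matrix_mul_right, inner_matrix_mul_left,
    ← inner_matrix_transpose (Xᵀ * L), Matrix.transpose_mul, Matrix.transpose_transpose,
    Matrix.transpose_transpose]

/-- The directions `(L S, -R Sᵀ)`, along which the product `L Rᵀ` is stationary. They are tangent to
the orbit of `(L, R)` under `(L, R) ↦ (L G, R G⁻ᵀ)`. -/
def gaugeDirection (L : Matrix (Fin p₁) (Fin r) ℝ) (R : Matrix (Fin p₂) (Fin r) ℝ) :
    Matrix (Fin r) (Fin r) ℝ →ₗ[ℝ] Matrix (Fin p₁ ⊕ Fin p₂) (Fin r) ℝ where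
  toFun S := Matrix.fromRows (L * S) (-(R * Sᵀ))
  map_add' S T := by
    rw [Matrix.transpose_add, Matrix.mul_add, Matrix.mul_add, neg_add]
    ext (i | i) j <;> simp
  map_smul' c S := by
    rw [Matrix.transpose_smul, Matrix.mul_smul, Matrix.mul_smul]
    ext (i | i) j <;> simp

lemma gaugeDirection_apply (S : Matrix (Fin r) (Fin r) ℝ) :
    gaugeDirection L R S = Matrix.fromRows (L * S) (-(R * Sᵀ)) := rfl

lemma eq_zero_of_mul_eq_zero_of_rank {n : Type*} (hL : L.rank = r) {S : Matrix (Fin r) n ℝ}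
    (h : L * S = 0) : S = 0 := by
  rw [← Matrix.one_mul S, ← Matrix.inv_gram_mul_gram hL, Matrix.mul_assoc, Matrix.mul_assoc, h,
    Matrix.mul_zero, Matrix.mul_zero]

lemma gaugeDirection_injective (hL : L.rank = r) : Function.Injective (gaugeDirection L R) := by
  refine (injective_iff_map_eq_zero _).2 fun S hS => eq_zero_of_mul_eq_zero_of_rank hL ?_
  exact congrArg Matrix.toRows₁ hS

lemma range_gaugeDirection (hL : L.rank = r) (hR : R.rank = r) :
    LinearMap.range (gaugeDirection L R) = LinearMap.ker (factorDeriv L R) := by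
  apply le_antisymm
  · rintro _ ⟨S, rfl⟩
    rw [LinearMap.mem_ker, factorDeriv_apply, gaugeDirection_apply, Matrix.toRows₁_fromRows,
      Matrix.toRows₂_fromRows, Matrix.transpose_neg, Matrix.transpose_mul,
      Matrix.transpose_transpose, Matrix.mul_neg, Matrix.mul_assoc, add_neg_cancel]
  · intro A hA
    rw [LinearMap.mem_ker, factorDeriv_apply] at hA
    -- Solve `A_L Rᵀ = -L A_Rᵀ` for `A_L` by cancelling `Rᵀ`, then for `A_Rᵀ` by cancelling `L`.
    set S := -(A.toRows₂ᵀ * (R * (Rᵀ * R)⁻¹)) with hS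
    have h1 : A.toRows₁ = L * S := by
      have h := congrArg (· * (R * (Rᵀ * R)⁻¹)) (eq_neg_of_add_eq_zero_left hA)
      simp only [Matrix.neg_mul] at h
      rw [Matrix.mul_assoc, ← Matrix.mul_assoc Rᵀ, Matrix.gram_mul_inv_gram hR,
        Matrix.mul_one] at h
      rw [h, hS, Matrix.mul_neg, Matrix.mul_assoc]
    have h2 : S * Rᵀ + A.toRows₂ᵀ = 0 := by
      refine eq_zero_of_mul_eq_zero_of_rank hL ?_
      rw [Matrix.mul_add, ← Matrix.mul_assoc, ← h1, hA]
    have h3 : A.toRows₂ = -(R * Sᵀ) := by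
      rw [← Matrix.transpose_transpose A.toRows₂, eq_neg_of_add_eq_zero_right h2,
        Matrix.transpose_neg, Matrix.transpose_mul, Matrix.transpose_transpose]
    refine ⟨S, ?_⟩
    rw [gaugeDirection_apply, ← h1, ← h3, Matrix.fromRows_toRows]

lemma finrank_ker_factorDeriv (hL : L.rank = r) (hR : R.rank = r) :
    Module.finrank ℝ (LinearMap.ker (factorDeriv L R)) = r ^ 2 := by
  rw [← range_gaugeDirection hL hR, LinearMap.finrank_range_of_inj (gaugeDirection_injective hL),
    Module.finrank_matrix]
  simp [sq]

lemma finrank_range_factorDeriv (hL : L.rank = r) (hR : R.rank = r) :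
    Module.finrank ℝ (LinearMap.range (factorDeriv L R)) = (p₁ + p₂ - r) * r := by
  have h := (factorDeriv L R).finrank_range_add_finrank_ker
  rw [finrank_ker_factorDeriv hL hR, Module.finrank_matrix] at h
  simp only [Fintype.card_sum, Fintype.card_fin, Module.finrank_self, mul_one] at h
  rw [Nat.sub_mul, ← h, sq, Nat.add_sub_cancel]

/-- Orthogonality to the gauge directions is the balancing condition `Lᵀ A_L = A_Rᵀ R`. -/
lemma mem_orthogonal_ker_factorDeriv_iff (hL : L.rank = r) (hR : R.rank = r)
    {A : Matrix (Fin p₁ ⊕ Fin p₂) (Fin r) ℝ} :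
    A ∈ (LinearMap.ker (factorDeriv L R))ᗮ ↔ Lᵀ * A.toRows₁ = A.toRows₂ᵀ * R := by
  have key : ∀ S, ⟪A, gaugeDirection L R S⟫_ℝ = ⟪Lᵀ * A.toRows₁ - A.toRows₂ᵀ * R, S⟫_ℝ := by
    intro S
    rw [inner_matrix_stacked, gaugeDirection_apply, Matrix.toRows₁_fromRows,
      Matrix.toRows₂_fromRows, inner_neg_right, inner_matrix_mul_left, inner_matrix_mul_left,
      inner_sub_left, ← inner_matrix_transpose (Rᵀ * A.toRows₂), Matrix.transpose_mul,
      Matrix.transpose_transpose, Matrix.transpose_transpose, sub_eq_add_neg]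
  rw [Submodule.mem_orthogonal', ← range_gaugeDirection hL hR]
  constructor
  · intro h
    rw [← sub_eq_zero, ← inner_self_eq_zero (𝕜 := ℝ), ← key]
    exact h _ ⟨_, rfl⟩
  · rintro h _ ⟨S, rfl⟩
    rw [key, sub_eq_zero.2 h, inner_zero_left]

lemma norm_sq_factorDeriv_le (A : Matrix (Fin p₁ ⊕ Fin p₂) (Fin r) ℝ) :
    ‖factorDeriv L R A‖ ^ 2 ≤
      2 * max (matrixSingularValue L 1) (matrixSingularValue R 1) ^ 2 * ‖A‖ ^ 2 := by
  set μ := max (matrixSingularValue L 1) (matrixSingularValue R 1)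
  have h1 : ‖A.toRows₁ * Rᵀ‖ ^ 2 ≤ μ ^ 2 * ‖A.toRows₁‖ ^ 2 :=
    (Matrix.norm_sq_mul_transpose_le R A.toRows₁).trans (mul_le_mul_of_nonneg_right
      (pow_le_pow_left₀ (matrixSingularValue_nonneg _ _) (le_max_right _ _) 2) (sq_nonneg _))
  have h2 : ‖L * A.toRows₂ᵀ‖ ^ 2 ≤ μ ^ 2 * ‖A.toRows₂‖ ^ 2 := by
    rw [← Matrix.frobenius_norm_transpose, Matrix.transpose_mul, Matrix.transpose_transpose]
    exact (Matrix.norm_sq_mul_transpose_le L A.toRows₂).trans (mul_le_mul_of_nonneg_right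
      (pow_le_pow_left₀ (matrixSingularValue_nonneg _ _) (le_max_left _ _) 2) (sq_nonneg _))
  have h3 : ‖factorDeriv L R A‖ ^ 2 ≤ (‖A.toRows₁ * Rᵀ‖ + ‖L * A.toRows₂ᵀ‖) ^ 2 :=
    pow_le_pow_left₀ (norm_nonneg _) (norm_add_le _ _) 2
  have h4 := norm_sq_matrix_stacked A
  nlinarith [sq_nonneg (‖A.toRows₁ * Rᵀ‖ - ‖L * A.toRows₂ᵀ‖)]

/-- On the orthogonal complement of the kernel the cross term
`2 ⟪A_L Rᵀ, L A_Rᵀ⟫ = 2 ‖Lᵀ A_L‖²` is nonnegative. -/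
lemma le_norm_sq_factorDeriv (hL : L.rank = r) (hR : R.rank = r)
    {A : Matrix (Fin p₁ ⊕ Fin p₂) (Fin r) ℝ} (hA : A ∈ (LinearMap.ker (factorDeriv L R))ᗮ) :
    min (matrixSingularValue L r) (matrixSingularValue R r) ^ 2 * ‖A‖ ^ 2 ≤
      ‖factorDeriv L R A‖ ^ 2 := by
  set ν := min (matrixSingularValue L r) (matrixSingularValue R r)
  have hν : 0 ≤ ν := le_min (matrixSingularValue_nonneg _ _) (matrixSingularValue_nonneg _ _)
  have h1 : ν ^ 2 * ‖A.toRows₁‖ ^ 2 ≤ ‖A.toRows₁ * Rᵀ‖ ^ 2 :=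
    (mul_le_mul_of_nonneg_right (pow_le_pow_left₀ hν (min_le_right _ _) 2)
      (sq_nonneg _)).trans (Matrix.le_norm_sq_mul_transpose R A.toRows₁)
  have h2 : ν ^ 2 * ‖A.toRows₂‖ ^ 2 ≤ ‖L * A.toRows₂ᵀ‖ ^ 2 := by
    rw [← Matrix.frobenius_norm_transpose (L * _), Matrix.transpose_mul,
      Matrix.transpose_transpose]
    exact (mul_le_mul_of_nonneg_right (pow_le_pow_left₀ hν (min_le_left _ _) 2)
      (sq_nonneg _)).trans (Matrix.le_norm_sq_mul_transpose L A.toRows₂)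
  have h3 : 0 ≤ ⟪A.toRows₁ * Rᵀ, L * A.toRows₂ᵀ⟫_ℝ := by
    rw [inner_matrix_mul_left, real_inner_comm, ← Matrix.mul_assoc, inner_matrix_mul_right,
      Matrix.transpose_transpose, (mem_orthogonal_ker_factorDeriv_iff hL hR).1 hA]
    exact real_inner_self_nonneg
  rw [factorDeriv_apply, norm_add_sq_real, norm_sq_matrix_stacked A]
  linarith

end FactorizationKernel

/-! ### Gradients -/

section FixedRankGradient

lemma gradient_eq_of_inner {E : Type*} [NormedAddCommGroup E] [InnerProductSpace ℝ E]
    [CompleteSpace E] {F : E → ℝ} {x G : E} (h : ∀ Z, ⟪G, Z⟫_ℝ = fderiv ℝ F x Z) :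
    gradient F x = G :=
  ext_inner_right ℝ fun Z => by rw [inner_gradient_left, h]

/-- `inner_gradient_left` for the Frobenius inner product, with the derivative taken for the
Frobenius normed structure on matrices. -/
lemma inner_gradient_matrix {m n : Type*} [Fintype m] [Fintype n] (f : Matrix m n ℝ → ℝ)
    (X Z : Matrix m n ℝ) : ⟪gradient f X, Z⟫_ℝ = fderiv ℝ f X Z :=
  inner_gradient_left

lemma gradient_matrix_eq_of_inner {m n : Type*} [Fintype m] [Fintype n] {f : Matrix m n ℝ → ℝ}
    {X G : Matrix m n ℝ} (h : ∀ Z, ⟪G, Z⟫_ℝ = fderiv ℝ f X Z) : gradient f X = G :=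
  gradient_eq_of_inner h

variable {p₁ p₂ r : ℕ} {L : Matrix (Fin p₁) (Fin r) ℝ} {R : Matrix (Fin p₂) (Fin r) ℝ}
  {f : Matrix (Fin p₁) (Fin p₂) ℝ → ℝ}

lemma fderiv_comp_apply_of_eq {E F : Type*} [NormedAddCommGroup E] [NormedSpace ℝ E]
    [NormedAddCommGroup F] [NormedSpace ℝ F] {h : F → ℝ} {φ : E → F} {x Z : E} {v : F}
    (hh : DifferentiableAt ℝ h (φ x)) (hφ : DifferentiableAt ℝ φ x) (hv : fderiv ℝ φ x Z = v) :
    fderiv ℝ (fun y => h (φ y)) x Z = fderiv ℝ h (φ x) v := by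
  rw [← hv]
  exact congrArg (· Z) (fderiv_comp x hh hφ)

lemma gradient_factorObjective (hf : ContDiff ℝ 2 f) :
    gradient (factorObjective f) (Matrix.fromRows L R) =
      Matrix.fromRows (gradient f (L * Rᵀ) * R) ((gradient f (L * Rᵀ))ᵀ * L) := by
  refine gradient_matrix_eq_of_inner fun Z => ?_
  have h : fderiv ℝ (factorObjective f) (Matrix.fromRows L R) Z =
      fderiv ℝ f (L * Rᵀ) (factorDeriv L R Z) :=
    fderiv_comp_apply_of_eq (hf.differentiable two_ne_zero _)
      (contDiff_factorProduct.differentiable one_ne_zero _) (fderiv_factorProduct Z)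
  rw [h, ← inner_gradient_matrix, inner_factorDeriv, inner_matrix_stacked,
    Matrix.toRows₁_fromRows, Matrix.toRows₂_fromRows]

lemma gradient_left (hf : ContDiff ℝ 2 f) :
    gradient (fun L' : Matrix (Fin p₁) (Fin r) ℝ => f (L' * Rᵀ)) L =
      gradient f (L * Rᵀ) * R := by
  refine gradient_matrix_eq_of_inner fun Z => ?_
  let T : Matrix (Fin p₁) (Fin r) ℝ →L[ℝ] Matrix (Fin p₁) (Fin p₂) ℝ :=
    LinearMap.toContinuousLinearMap
      { toFun := fun Z => Z * Rᵀ
        map_add' := fun _ _ => Matrix.add_mul _ _ _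
        map_smul' := fun _ _ => Matrix.smul_mul _ _ _ }
  have h : fderiv ℝ (fun L' => f (T L')) L Z = fderiv ℝ f (T L) (Z * Rᵀ) :=
    fderiv_comp_apply_of_eq (hf.differentiable two_ne_zero _) T.differentiableAt
      (DFunLike.congr_fun T.hasFDerivAt.fderiv Z)
  refine Eq.trans ?_ h.symm
  rw [← inner_gradient_matrix, inner_matrix_mul_right, Matrix.transpose_transpose]
  rfl

lemma gradient_right (hf : ContDiff ℝ 2 f) :
    gradient (fun R' : Matrix (Fin p₂) (Fin r) ℝ => f (L * R'ᵀ)) R =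
      (gradient f (L * Rᵀ))ᵀ * L := by
  refine gradient_matrix_eq_of_inner fun Z => ?_
  let T : Matrix (Fin p₂) (Fin r) ℝ →L[ℝ] Matrix (Fin p₁) (Fin p₂) ℝ :=
    LinearMap.toContinuousLinearMap
      { toFun := fun Z => L * Zᵀ
        map_add' := fun A B => by rw [Matrix.transpose_add, Matrix.mul_add]
        map_smul' := fun c A => by rw [Matrix.transpose_smul, Matrix.mul_smul, RingHom.id_apply] }
  have h : fderiv ℝ (fun R' => f (T R')) R Z = fderiv ℝ f (T R) (L * Zᵀ) :=
    fderiv_comp_apply_of_eq (hf.differentiable two_ne_zero _) T.differentiableAt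
      (DFunLike.congr_fun T.hasFDerivAt.fderiv Z)
  refine Eq.trans ?_ h.symm
  rw [← inner_gradient_matrix, inner_matrix_mul_left, ← inner_matrix_transpose (Lᵀ * _),
    Matrix.transpose_mul, Matrix.transpose_transpose, Matrix.transpose_transpose]
  rfl

/-- The orthogonal projection of `D` to the tangent space at a matrix whose column and row spaces
are those of `L` and `R`, both of full column rank. -/
noncomputable def tangentProjection (L : Matrix (Fin p₁) (Fin r) ℝ) (R : Matrix (Fin p₂) (Fin r) ℝ)
    (D : Matrix (Fin p₁) (Fin p₂) ℝ) : Matrix (Fin p₁) (Fin p₂) ℝ :=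
  D * columnProjection R + columnProjection L * (D * (1 - columnProjection R))

lemma tangentProjection_mul (hR : R.rank = r) (D : Matrix (Fin p₁) (Fin p₂) ℝ) :
    tangentProjection L R D * R = D * R := by
  simp only [tangentProjection, Matrix.add_mul, Matrix.mul_assoc, Matrix.sub_mul, Matrix.one_mul,
    columnProjection_mul hR, sub_self, Matrix.mul_zero, add_zero]

lemma transpose_mul_tangentProjection (hL : L.rank = r) (D : Matrix (Fin p₁) (Fin p₂) ℝ) :
    Lᵀ * tangentProjection L R D = Lᵀ * D := by
  rw [tangentProjection, Matrix.mul_add, ← Matrix.mul_assoc Lᵀ (columnProjection L),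
    transpose_mul_columnProjection hL, ← Matrix.mul_add, ← Matrix.mul_add, add_sub_cancel,
    Matrix.mul_one]

lemma transpose_tangentProjection_mul (hL : L.rank = r) (D : Matrix (Fin p₁) (Fin p₂) ℝ) :
    (tangentProjection L R D)ᵀ * L = Dᵀ * L := by
  rw [← Matrix.transpose_transpose L, ← Matrix.transpose_mul, ← Matrix.transpose_mul,
    Matrix.transpose_transpose, transpose_mul_tangentProjection hL]

lemma tangentProjection_mem_range (D : Matrix (Fin p₁) (Fin p₂) ℝ) :
    tangentProjection L R D ∈ LinearMap.range (factorDeriv L R) := by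
  refine ⟨Matrix.fromRows (D * (R * (Rᵀ * R)⁻¹))
    (((Lᵀ * L)⁻¹ * Lᵀ * (D * (1 - columnProjection R)))ᵀ), ?_⟩
  rw [factorDeriv_apply, Matrix.toRows₁_fromRows, Matrix.toRows₂_fromRows,
    Matrix.transpose_transpose, tangentProjection, columnProjection, columnProjection]
  simp only [Matrix.mul_assoc]

theorem riemannianGradient_fixedRank (hL : L.rank = r) (hR : R.rank = r) :
    (riemannianGradient (fixedRank p₁ p₂ r) f (L * Rᵀ) : Matrix (Fin p₁) (Fin p₂) ℝ) =
      tangentProjection L R (gradient f (L * Rᵀ)) := by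
  refine riemannianGradient_eq_of_inner ?_ ?_ <;> rw [tangentSpaceAt_fixedRank hL hR]
  · exact tangentProjection_mem_range _
  · rintro _ ⟨A, rfl⟩
    rw [inner_factorDeriv, tangentProjection_mul hR, transpose_tangentProjection_mul hL,
      ← inner_factorDeriv]
    exact inner_gradient_matrix f _ _

/-- Along the local section the gradient is given by a formula that is differentiable in the
ambient space. -/
lemma differentiableWithinAt_riemannianGradient (hf : ContDiff ℝ 2 f) (hL : L.rank = r)
    (hR : R.rank = r) :
    DifferentiableWithinAt ℝ (fun Y : Matrix (Fin p₁) (Fin p₂) ℝ =>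
      (riemannianGradient (fixedRank p₁ p₂ r) f Y : Matrix (Fin p₁) (Fin p₂) ℝ))
      (fixedRank p₁ p₂ r) (L * Rᵀ) := by
  set X := L * Rᵀ
  have hX : X ∈ fixedRank p₁ p₂ r := Matrix.rank_mul_transpose_of_rank hL hR
  have hK0 : (sectionLeft R X).rank = r := by rw [sectionLeft_mul_transpose hR, hL]
  have hev : ∀ Y ∈ fixedRank p₁ p₂ r, (sectionLeft R Y).rank = r →
      (riemannianGradient (fixedRank p₁ p₂ r) f Y : Matrix (Fin p₁) (Fin p₂) ℝ) =
        tangentProjection (sectionLeft R Y) (sectionRight R Y)ᵀ (gradient f Y) := by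
    intro Y hY hK
    have h := riemannianGradient_fixedRank (f := f) hK (rank_transpose_sectionRight hY hK)
    rwa [Matrix.transpose_transpose, sectionLeft_mul_sectionRight hY hK] at h
  have hd1 : DifferentiableAt ℝ (fun Y => columnProjection (sectionLeft R Y)) X :=
    (differentiable_sectionLeft X).columnProjection hK0
  have hd2 : DifferentiableAt ℝ (fun Y => columnProjection (sectionRight R Y)ᵀ) X :=
    (differentiableAt_sectionRight hK0).matrix_transpose.columnProjection
      (rank_transpose_sectionRight hX hK0)
  have hd3 : DifferentiableAt ℝ (fun Y => gradient f Y) X := differentiable_gradient hf X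
  have hd : DifferentiableAt ℝ (fun Y => tangentProjection (sectionLeft R Y) (sectionRight R Y)ᵀ
      (gradient f Y)) X :=
    (hd3.matrix_mul hd2).add (hd1.matrix_mul (hd3.matrix_mul ((differentiableAt_const _).sub hd2)))
  refine hd.differentiableWithinAt.congr_of_eventuallyEq ?_ (hev X hX hK0)
  filter_upwards [self_mem_nhdsWithin, nhdsWithin_le_nhds
    ((differentiable_sectionLeft.continuous.continuousAt).eventually_rank_eq hK0)] with Y hY hK
  exact hev Y hY hK

end FixedRankGradient

/-! ### Hessians -/

section FixedRankHessian

variable {p₁ p₂ r : ℕ} {L : Matrix (Fin p₁) (Fin r) ℝ} {R : Matrix (Fin p₂) (Fin r) ℝ}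
  {f : Matrix (Fin p₁) (Fin p₂) ℝ → ℝ}

lemma factorDeriv_mem_tangentSpaceAt (hL : L.rank = r) (hR : R.rank = r)
    (A : Matrix (Fin p₁ ⊕ Fin p₂) (Fin r) ℝ) :
    factorDeriv L R A ∈ tangentSpaceAt (fixedRank p₁ p₂ r) (L * Rᵀ) := by
  rw [tangentSpaceAt_fixedRank hL hR]
  exact ⟨A, rfl⟩

/-- The derivative of the product `L Rᵀ` as a map onto the tangent space of the matrices of
rank `r`. -/
noncomputable def tangentFactorDeriv (hL : L.rank = r) (hR : R.rank = r) :
    Matrix (Fin p₁ ⊕ Fin p₂) (Fin r) ℝ →ₗ[ℝ] tangentSpaceAt (fixedRank p₁ p₂ r) (L * Rᵀ) :=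
  (factorDeriv L R).codRestrict _ (factorDeriv_mem_tangentSpaceAt hL hR)

lemma tangentFactorDeriv_surjective (hL : L.rank = r) (hR : R.rank = r) :
    Function.Surjective (tangentFactorDeriv hL hR) := by
  rintro ⟨ξ, hξ⟩
  obtain ⟨A, rfl⟩ := (tangentSpaceAt_fixedRank hL hR).le hξ
  exact ⟨A, rfl⟩

lemma contDiff_factorObjective (hf : ContDiff ℝ 2 f) :
    ContDiff ℝ 2 (factorObjective (r := r) f) :=
  hf.comp contDiff_factorProduct

/-- The second-order chain rule for the parametrization `(L, R) ↦ L Rᵀ`. -/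
lemma inner_euclideanHessian_factorObjective (hf : ContDiff ℝ 2 f) (hL : L.rank = r)
    (hR : R.rank = r) (A B : Matrix (Fin p₁ ⊕ Fin p₂) (Fin r) ℝ) :
    ⟪euclideanHessian (factorObjective f) (Matrix.fromRows L R) A, B⟫_ℝ =
      ⟪riemannianHessian (fixedRank p₁ p₂ r) f (L * Rᵀ) (tangentFactorDeriv hL hR A),
        tangentFactorDeriv hL hR B⟫_ℝ +
      ⟪(riemannianGradient (fixedRank p₁ p₂ r) f (L * Rᵀ) : Matrix (Fin p₁) (Fin p₂) ℝ),
        fderiv ℝ (fderiv ℝ factorProduct) (Matrix.fromRows L R) A B⟫_ℝ := by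
  have h := inner_euclideanHessian_comp (φ := factorProduct) contDiff_factorProduct hf
    (eventually_factorProduct_mem_fixedRank hL hR)
    (differentiableWithinAt_riemannianGradient hf hL hR) A B
  have hA : tangentFactorDeriv hL hR A = ⟨fderiv ℝ factorProduct (Matrix.fromRows L R) A,
      fderiv_mem_tangentSpaceAt contDiff_factorProduct
        (eventually_factorProduct_mem_fixedRank hL hR) A⟩ :=
    Subtype.ext (fderiv_factorProduct A).symm
  have hB : tangentFactorDeriv hL hR B = ⟨fderiv ℝ factorProduct (Matrix.fromRows L R) B,
      fderiv_mem_tangentSpaceAt contDiff_factorProduct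
        (eventually_factorProduct_mem_fixedRank hL hR) B⟩ :=
    Subtype.ext (fderiv_factorProduct B).symm
  rw [hA, hB]
  exact h

/-- The Riemannian Hessian is symmetric because the other two bilinear forms in the second-order
chain rule are second derivatives. -/
theorem riemannianHessian_fixedRank_isSymmetric (hf : ContDiff ℝ 2 f) (hL : L.rank = r)
    (hR : R.rank = r) : (riemannianHessian (fixedRank p₁ p₂ r) f (L * Rᵀ)).IsSymmetric := by
  intro ξ η
  obtain ⟨A, rfl⟩ := tangentFactorDeriv_surjective hL hR ξ
  obtain ⟨B, rfl⟩ := tangentFactorDeriv_surjective hL hR η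
  have h1 := inner_euclideanHessian_factorObjective hf hL hR A B
  have h2 := inner_euclideanHessian_factorObjective hf hL hR B A
  have h3 := euclideanHessian_isSymmetric (contDiff_factorObjective hf) (Matrix.fromRows L R) A B
  have h4 : fderiv ℝ (fderiv ℝ factorProduct) (Matrix.fromRows L R) A B =
      fderiv ℝ (fderiv ℝ factorProduct) (Matrix.fromRows L R) B A :=
    ((contDiff_factorProduct (k := 2)).contDiffAt.isSymmSndFDerivAt (by simp)).eq A B
  rw [h4] at h1
  refine Eq.trans ?_ (real_inner_comm _ _)
  have h5 := h3.trans (real_inner_comm _ _).symm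
  linarith

/-- Stationarity in the factors gives `∇f(X) R = 0` and `∇f(X)ᵀ L = 0`, so `∇f(X)` is normal. -/
lemma riemannianGradient_eq_zero (hf : ContDiff ℝ 2 f) (hL : L.rank = r) (hR : R.rank = r)
    (h0 : gradient (factorObjective f) (Matrix.fromRows L R) = 0) :
    (riemannianGradient (fixedRank p₁ p₂ r) f (L * Rᵀ) : Matrix (Fin p₁) (Fin p₂) ℝ) = 0 := by
  rw [gradient_factorObjective hf] at h0
  refine riemannianGradient_eq_of_inner (Submodule.zero_mem _) ?_
  rw [tangentSpaceAt_fixedRank hL hR]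
  rintro _ ⟨A, rfl⟩
  have h1 : gradient f (L * Rᵀ) * R = 0 := congrArg Matrix.toRows₁ h0
  have h2 : (gradient f (L * Rᵀ))ᵀ * L = 0 := congrArg Matrix.toRows₂ h0
  have h3 := inner_factorDeriv (L := L) (R := R) (gradient f (L * Rᵀ)) A
  rw [h1, h2, inner_zero_left, inner_zero_left, add_zero, inner_gradient_matrix] at h3
  rw [inner_zero_left]
  exact h3.symm

lemma inner_euclideanHessian_of_stationary (hf : ContDiff ℝ 2 f) (hL : L.rank = r)
    (hR : R.rank = r) (h0 : gradient (factorObjective f) (Matrix.fromRows L R) = 0)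
    (A B : Matrix (Fin p₁ ⊕ Fin p₂) (Fin r) ℝ) :
    ⟪euclideanHessian (factorObjective f) (Matrix.fromRows L R) A, B⟫_ℝ =
      ⟪riemannianHessian (fixedRank p₁ p₂ r) f (L * Rᵀ) (tangentFactorDeriv hL hR A),
        tangentFactorDeriv hL hR B⟫_ℝ := by
  rw [inner_euclideanHessian_factorObjective hf hL hR, riemannianGradient_eq_zero hf hL hR h0,
    inner_zero_left, add_zero]

lemma ker_factorDeriv_le_ker_euclideanHessian (hf : ContDiff ℝ 2 f) (hL : L.rank = r)
    (hR : R.rank = r) (h0 : gradient (factorObjective f) (Matrix.fromRows L R) = 0) :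
    LinearMap.ker (factorDeriv L R) ≤
      LinearMap.ker (euclideanHessian (factorObjective f) (Matrix.fromRows L R)) := by
  intro A hA
  have h : tangentFactorDeriv hL hR A = 0 := Subtype.ext hA
  rw [LinearMap.mem_ker, ← inner_self_eq_zero (𝕜 := ℝ),
    inner_euclideanHessian_of_stationary hf hL hR h0, h, map_zero, inner_zero_left]

/-- The derivative of `L Rᵀ`, restricted to the orthogonal complement of its kernel, is an
isomorphism onto the tangent space. -/
noncomputable def orthogonalEquivTangent (hL : L.rank = r) (hR : R.rank = r) :
    (LinearMap.ker (factorDeriv L R))ᗮ ≃ₗ[ℝ] tangentSpaceAt (fixedRank p₁ p₂ r) (L * Rᵀ) :=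
  LinearEquiv.ofBijective ((tangentFactorDeriv hL hR).comp (Submodule.subtype _)) <| by
    constructor
    · refine (injective_iff_map_eq_zero _).2 fun A hA => Subtype.ext ?_
      have h : (A : Matrix (Fin p₁ ⊕ Fin p₂) (Fin r) ℝ) ∈ LinearMap.ker (factorDeriv L R) :=
        congrArg Subtype.val hA
      exact inner_self_eq_zero (𝕜 := ℝ).1 (A.2 _ h)
    · intro ξ
      obtain ⟨A, rfl⟩ := tangentFactorDeriv_surjective hL hR ξ
      obtain ⟨B, hB, C, hC, rfl⟩ :=
        (LinearMap.ker (factorDeriv L R)).exists_add_mem_mem_orthogonal A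
      refine ⟨⟨C, hC⟩, Subtype.ext ?_⟩
      have hB' : factorDeriv L R B = 0 := hB
      change factorDeriv L R C = factorDeriv L R (B + C)
      rw [map_add, hB', zero_add]

end FixedRankHessian

/-! ### Coordinates from the singular value decomposition -/

section SingularValueDecomposition

variable {p₁ p₂ r : ℕ} {L : Matrix (Fin p₁) (Fin r) ℝ} {R : Matrix (Fin p₂) (Fin r) ℝ}
  {U : Matrix (Fin p₁) (Fin r) ℝ} {U' : Matrix (Fin p₁) (Fin (p₁ - r)) ℝ} {s : Fin r → ℝ}
  {V : Matrix (Fin p₂) (Fin r) ℝ} {V' : Matrix (Fin p₂) (Fin (p₂ - r)) ℝ}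

lemma mul_transpose_add_eq_one_of_orthonormal {p : ℕ} {U : Matrix (Fin p) (Fin r) ℝ}
    {U' : Matrix (Fin p) (Fin (p - r)) ℝ} (hr : r ≤ p) (h1 : Uᵀ * U = 1) (h2 : U'ᵀ * U' = 1)
    (h3 : Uᵀ * U' = 0) : U * Uᵀ + U' * U'ᵀ = 1 := by
  have h4 : U'ᵀ * U = 0 := by rw [← Matrix.transpose_transpose U, ← Matrix.transpose_mul, h3,
    Matrix.transpose_zero]
  have h : (Matrix.fromCols U U')ᵀ * Matrix.fromCols U U' = 1 := by
    rw [Matrix.transpose_fromCols, Matrix.fromRows_mul_fromCols, h1, h2, h3, h4,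
      Matrix.fromBlocks_one]
  have h' := (Matrix.mul_eq_one_comm_of_card_eq _ _ _ (by simp; omega)).1 h
  rwa [Matrix.transpose_fromCols, Matrix.fromCols_mul_fromRows] at h'

namespace IsCompactSVD

/-- The column space of `L` is that of `X = L Rᵀ`, hence that of `U`. -/
lemma left_factor (h : IsCompactSVD (L * Rᵀ) U U' s V V') (hR : R.rank = r) :
    U * (Uᵀ * L) = L := by
  have h1 : L = U * (Matrix.diagonal s * Vᵀ * (R * (Rᵀ * R)⁻¹)) := by
    rw [← Matrix.mul_assoc, ← Matrix.mul_assoc U, ← h.eq]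
    exact (sectionLeft_mul_transpose hR).symm
  rw [h1, ← Matrix.mul_assoc Uᵀ, h.left_orthonormal, Matrix.one_mul]

lemma transpose (h : IsCompactSVD (L * Rᵀ) U U' s V V') :
    IsCompactSVD (R * Lᵀ) V V' s U U' where
  left_orthonormal := h.right_orthonormal
  left_compl_orthonormal := h.right_compl_orthonormal
  left_orthogonal := h.right_orthogonal
  right_orthonormal := h.left_orthonormal
  right_compl_orthonormal := h.left_compl_orthonormal
  right_orthogonal := h.left_orthogonal
  pos := h.pos
  antitone := h.antitone
  eq := by
    rw [← Matrix.transpose_transpose R, ← Matrix.transpose_mul, h.eq, Matrix.transpose_mul,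
      Matrix.transpose_mul, Matrix.transpose_transpose, Matrix.diagonal_transpose,
      Matrix.mul_assoc]

lemma isUnit_det_left (h : IsCompactSVD (L * Rᵀ) U U' s V V') (hL : L.rank = r)
    (hR : R.rank = r) : IsUnit (Uᵀ * L).det := by
  have h1 : (Uᵀ * L)ᵀ * (Uᵀ * L) = Lᵀ * L := by
    rw [Matrix.transpose_mul, Matrix.transpose_transpose, Matrix.mul_assoc, h.left_factor hR]
  have h2 := (Matrix.rank_eq_iff_isUnit_det_transpose_mul_self L).1 hL
  rw [← h1, Matrix.det_mul] at h2
  exact isUnit_of_mul_isUnit_right h2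

lemma left_complete (h : IsCompactSVD (L * Rᵀ) U U' s V V') (hL : L.rank = r) :
    U * Uᵀ + U' * U'ᵀ = 1 :=
  mul_transpose_add_eq_one_of_orthonormal (hL ▸ L.rank_le_height) h.left_orthonormal
    h.left_compl_orthonormal h.left_orthogonal

/-- Because `U P₁ = L`, `V P₂ = R` and `[V V']` is orthogonal, `ξ^A` is the derivative of `L Rᵀ`
along `A`. -/
lemma xiOf_eq (h : IsCompactSVD (L * Rᵀ) U U' s V V') (hL : L.rank = r) (hR : R.rank = r)
    (A : Matrix (Fin p₁ ⊕ Fin p₂) (Fin r) ℝ) : xiOf U U' V V' L R A = factorDeriv L R A := by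
  have h1 : L * A.toRows₂ᵀ * (V * Vᵀ + V' * V'ᵀ) = L * A.toRows₂ᵀ := by
    rw [h.transpose.left_complete hR, Matrix.mul_one]
  have h2 : (U * Uᵀ + U' * U'ᵀ) * A.toRows₁ * Rᵀ = A.toRows₁ * Rᵀ := by
    rw [h.left_complete hL, Matrix.one_mul]
  have h3 : (Vᵀ * R)ᵀ * Vᵀ = Rᵀ := by
    rw [← Matrix.transpose_mul, h.transpose.left_factor hL]
  have h4 := h.left_factor hR
  rw [factorDeriv_apply, ← h1, ← h2, xiOf, Matrix.transpose_fromCols,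
    Matrix.fromCols_mul_fromBlocks, Matrix.fromCols_mul_fromRows, ← h3]
  conv_rhs => rw [← h4]
  simp only [Matrix.mul_add, Matrix.add_mul, Matrix.mul_zero, add_zero, Matrix.mul_assoc]
  abel

/-- The substitution is `S ↦ P₁ S P₂ᵀ` in the gauge directions `(L S, -R Sᵀ)`. -/
lemma nullSubspace_eq (h : IsCompactSVD (L * Rᵀ) U U' s V V') (hL : L.rank = r)
    (hR : R.rank = r) : nullSubspace U V L R = LinearMap.ker (factorDeriv L R) := by
  have hP₁ := h.isUnit_det_left hL hR
  have hP₂ := h.transpose.isUnit_det_left hR hL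
  have h1 := h.left_factor hR
  have h2 := h.transpose.left_factor hL
  rw [← range_gaugeDirection hL hR]
  have key : ∀ S, gaugeDirection L R S =
      Matrix.fromRows (U * ((Uᵀ * L) * S * (Vᵀ * R)ᵀ) * ((Vᵀ * R)ᵀ)⁻¹)
        (-(V * ((Uᵀ * L) * S * (Vᵀ * R)ᵀ)ᵀ * ((Uᵀ * L)ᵀ)⁻¹)) := by
    intro S
    have e1 : U * ((Uᵀ * L) * S * (Vᵀ * R)ᵀ) * ((Vᵀ * R)ᵀ)⁻¹ = L * S := by
      rw [← Matrix.mul_assoc U, Matrix.mul_nonsing_inv_cancel_right _ _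
        (by rwa [Matrix.det_transpose]), ← Matrix.mul_assoc, h1]
    have e2 : V * ((Uᵀ * L) * S * (Vᵀ * R)ᵀ)ᵀ * ((Uᵀ * L)ᵀ)⁻¹ = R * Sᵀ := by
      rw [Matrix.transpose_mul, Matrix.transpose_mul (Uᵀ * L), Matrix.transpose_transpose,
        ← Matrix.mul_assoc, ← Matrix.mul_assoc, Matrix.mul_nonsing_inv_cancel_right _ _
        (by rwa [Matrix.det_transpose]), h2]
    rw [e1, e2, gaugeDirection_apply]
  apply le_antisymm
  · rintro _ ⟨S, rfl⟩
    refine ⟨(Uᵀ * L)⁻¹ * S * ((Vᵀ * R)ᵀ)⁻¹, ?_⟩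
    have e : (Uᵀ * L) * ((Uᵀ * L)⁻¹ * S * ((Vᵀ * R)ᵀ)⁻¹) * (Vᵀ * R)ᵀ = S := by
      rw [← Matrix.mul_assoc, Matrix.mul_nonsing_inv_cancel_left _ _ hP₁,
        Matrix.nonsing_inv_mul_cancel_right _ _ (by rwa [Matrix.det_transpose])]
    rw [key, e]
  · rintro _ ⟨S, rfl⟩
    exact ⟨_, key S⟩

/-- In the coordinates of the singular value decomposition, the balancing condition
`Lᵀ A_L = A_Rᵀ R` reads `P₁ᵀ (Uᵀ A_L) = (Vᵀ A_R)ᵀ P₂`, which says that `Uᵀ A_L = S P₂` and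
`Vᵀ A_R = Sᵀ P₁` for a common `S`. -/
lemma nullComplement_eq (h : IsCompactSVD (L * Rᵀ) U U' s V V') (hL : L.rank = r)
    (hR : R.rank = r) :
    nullComplement U U' V V' L R = (LinearMap.ker (factorDeriv L R))ᗮ := by
  have hP₁ := h.isUnit_det_left hL hR
  have hP₂ := h.transpose.isUnit_det_left hR hL
  have hP₁' : IsUnit (Uᵀ * L)ᵀ.det := by rwa [Matrix.det_transpose]
  have hP₂' : IsUnit (Vᵀ * R)ᵀ.det := by rwa [Matrix.det_transpose]
  have h1 := h.left_factor hR
  have h2 := h.transpose.left_factor hL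
  have hLt : ∀ B : Matrix (Fin p₁) (Fin r) ℝ, Lᵀ * B = (Uᵀ * L)ᵀ * (Uᵀ * B) := fun B => by
    rw [← Matrix.mul_assoc, ← Matrix.transpose_mul, h1]
  have hRt : ∀ B : Matrix (Fin p₂) (Fin r) ℝ, Bᵀ * R = (Vᵀ * B)ᵀ * (Vᵀ * R) := fun B => by
    rw [Matrix.transpose_mul, Matrix.transpose_transpose, Matrix.mul_assoc, h2]
  ext A
  rw [mem_orthogonal_ker_factorDeriv_iff hL hR, hLt, hRt]
  change (∃ S D₁ D₂, _) ↔ _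
  generalize Uᵀ * L = P₁ at *
  generalize Vᵀ * R = P₂ at *
  constructor
  · rintro ⟨S, D₁, D₂, rfl⟩
    have e1 : Uᵀ * ((U * S * P₂ * P₂ᵀ + U' * D₁) * (P₂ᵀ)⁻¹) = S * P₂ := by
      rw [Matrix.add_mul, Matrix.mul_nonsing_inv_cancel_right _ _ hP₂', Matrix.mul_add,
        Matrix.mul_assoc U, ← Matrix.mul_assoc Uᵀ, h.left_orthonormal, Matrix.one_mul,
        Matrix.mul_assoc U', ← Matrix.mul_assoc Uᵀ U', h.left_orthogonal, Matrix.zero_mul, add_zero]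
    have e2 : Vᵀ * ((V * Sᵀ * P₁ * P₁ᵀ + V' * D₂) * (P₁ᵀ)⁻¹) = Sᵀ * P₁ := by
      rw [Matrix.add_mul, Matrix.mul_nonsing_inv_cancel_right _ _ hP₁', Matrix.mul_add,
        Matrix.mul_assoc V, ← Matrix.mul_assoc Vᵀ, h.right_orthonormal, Matrix.one_mul,
        Matrix.mul_assoc V', ← Matrix.mul_assoc Vᵀ V', h.right_orthogonal, Matrix.zero_mul,
        add_zero]
    rw [Matrix.toRows₁_fromRows, Matrix.toRows₂_fromRows, e1, e2, Matrix.transpose_mul,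
      Matrix.transpose_transpose, Matrix.mul_assoc]
  · intro hA
    have e1 : (Uᵀ * A.toRows₁ * P₂⁻¹)ᵀ * P₁ = Vᵀ * A.toRows₂ := by
      apply Matrix.transpose_injective
      rw [Matrix.transpose_mul, Matrix.transpose_transpose, ← Matrix.mul_assoc, hA,
        Matrix.mul_nonsing_inv_cancel_right _ _ hP₂]
    refine ⟨Uᵀ * A.toRows₁ * P₂⁻¹, U'ᵀ * A.toRows₁ * P₂ᵀ,
      V'ᵀ * A.toRows₂ * P₁ᵀ, ?_⟩
    have e2 : U * (Uᵀ * A.toRows₁ * P₂⁻¹) * P₂ * P₂ᵀ +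
        U' * (U'ᵀ * A.toRows₁ * P₂ᵀ) = A.toRows₁ * P₂ᵀ := by
      rw [← Matrix.mul_assoc U, Matrix.nonsing_inv_mul_cancel_right _ _ hP₂, ← Matrix.mul_assoc U',
        ← Matrix.add_mul, ← Matrix.mul_assoc, ← Matrix.mul_assoc, ← Matrix.add_mul,
        h.left_complete hL, Matrix.one_mul]
    have e3 : V * (Uᵀ * A.toRows₁ * P₂⁻¹)ᵀ * P₁ * P₁ᵀ +
        V' * (V'ᵀ * A.toRows₂ * P₁ᵀ) = A.toRows₂ * P₁ᵀ := by
      rw [Matrix.mul_assoc V, e1, ← Matrix.mul_assoc V', ← Matrix.add_mul, ← Matrix.mul_assoc,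
        ← Matrix.mul_assoc, ← Matrix.add_mul, h.transpose.left_complete hR, Matrix.one_mul]
    rw [e2, e3, Matrix.mul_nonsing_inv_cancel_right _ _ hP₁',
      Matrix.mul_nonsing_inv_cancel_right _ _ hP₂', Matrix.fromRows_toRows]

end IsCompactSVD

end SingularValueDecomposition

/-! ### The spectra at a stationary point -/

section StationarySpectrum

variable {p₁ p₂ r : ℕ} {L : Matrix (Fin p₁) (Fin r) ℝ} {R : Matrix (Fin p₂) (Fin r) ℝ}
  {f : Matrix (Fin p₁) (Fin p₂) ℝ → ℝ}

lemma finrank_tangentSpaceAt_fixedRank (hL : L.rank = r) (hR : R.rank = r) :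
    Module.finrank ℝ (tangentSpaceAt (fixedRank p₁ p₂ r) (L * Rᵀ)) = (p₁ + p₂ - r) * r := by
  rw [tangentSpaceAt_fixedRank hL hR, finrank_range_factorDeriv hL hR]

/-- At a stationary point the Hessian of `g` vanishes on the `r²`-dimensional space of gauge
directions. -/
lemma eigenvalueMultiset_euclideanHessian (hf : ContDiff ℝ 2 f) (hL : L.rank = r)
    (hR : R.rank = r) (h0 : gradient (factorObjective f) (Matrix.fromRows L R) = 0) :
    eigenvalueMultiset (euclideanHessian (factorObjective f) (Matrix.fromRows L R)) =
      Multiset.replicate (r ^ 2) 0 + eigenvalueMultiset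
        ((euclideanHessian (factorObjective f) (Matrix.fromRows L R)).restrict
          ((euclideanHessian_isSymmetric (contDiff_factorObjective hf)
            (Matrix.fromRows L R)).map_mem_orthogonal_of_le_ker
              (ker_factorDeriv_le_ker_euclideanHessian hf hL hR h0))) := by
  rw [← finrank_ker_factorDeriv hL hR]
  exact (euclideanHessian_isSymmetric (contDiff_factorObjective hf)
    (Matrix.fromRows L R)).eigenvalueMultiset_eq_replicate_add
      (ker_factorDeriv_le_ker_euclideanHessian hf hL hR h0)

/-- On the orthogonal complement of the kernel of `A ↦ A_L Rᵀ + L A_Rᵀ` the two Hessians are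
congruent through this map, whose squared singular values there lie in
`[min(σ_r(L), σ_r(R))², 2 max(σ₁(L), σ₁(R))²]`. -/
theorem kthLargest_euclideanHessian_mem_uIcc (hf : ContDiff ℝ 2 f) (hL : L.rank = r)
    (hR : R.rank = r) (h0 : gradient (factorObjective f) (Matrix.fromRows L R) = 0) {i : ℕ}
    (hi : i ∈ Finset.Icc 1 ((p₁ + p₂ - r) * r)) :
    kthLargest (eigenvalueMultiset (euclideanHessian (factorObjective f)
        (Matrix.fromRows L R)) - Multiset.replicate (r ^ 2) 0) i ∈
      Set.uIcc
        ((min (matrixSingularValue L r) (matrixSingularValue R r)) ^ 2 *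
          kthLargest (eigenvalueMultiset
            (riemannianHessian (fixedRank p₁ p₂ r) f (L * Rᵀ))) i)
        (2 * (max (matrixSingularValue L 1) (matrixSingularValue R 1)) ^ 2 *
          kthLargest (eigenvalueMultiset
            (riemannianHessian (fixedRank p₁ p₂ r) f (L * Rᵀ))) i) := by
  obtain ⟨hi1, hi2⟩ := Finset.mem_Icc.1 hi
  obtain ⟨j, rfl⟩ : ∃ j, i = j + 1 := ⟨i - 1, by omega⟩
  have hH := riemannianHessian_fixedRank_isSymmetric hf hL hR
  have hE := euclideanHessian_isSymmetric (contDiff_factorObjective hf) (Matrix.fromRows L R)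
  have hle := ker_factorDeriv_le_ker_euclideanHessian hf hL hR h0
  have hK := hE.restrict_invariant (hE.map_mem_orthogonal_of_le_ker hle)
  have hm := finrank_tangentSpaceAt_fixedRank hL hR
  have hn := (orthogonalEquivTangent hL hR).finrank_eq.trans hm
  rw [eigenvalueMultiset_euclideanHessian hf hL hR h0, add_tsub_cancel_left,
    kthLargest_eigenvalueMultiset hK hn ⟨j, hi2⟩, kthLargest_eigenvalueMultiset hH hm ⟨j, hi2⟩]
  exact hK.eigenvalues_mem_uIcc_of_congruence hH (orthogonalEquivTangent hL hR) hn hm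
    (fun A => inner_euclideanHessian_of_stationary hf hL hR h0 A A)
    (fun A => le_norm_sq_factorDeriv hL hR A.2) (fun A => norm_sq_factorDeriv_le A.1) _

end StationarySpectrum

theorem mainTheorem2 (p₁ p₂ r : ℕ) (hr : 0 < r)
    (f : Matrix (Fin p₁) (Fin p₂) ℝ → ℝ) (hf : ContDiff ℝ 2 f)
    (L : Matrix (Fin p₁) (Fin r) ℝ) (R : Matrix (Fin p₂) (Fin r) ℝ)
    (hL : L.rank = r) (hR : R.rank = r) (hX : (L * Rᵀ).rank = r) :
    -- the Riemannian gradient from the partial Euclidean gradients, and conversely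
    ((riemannianGradient (fixedRank p₁ p₂ r) f (L * Rᵀ) : Matrix (Fin p₁) (Fin p₂) ℝ) =
        gradient (fun L' : Matrix (Fin p₁) (Fin r) ℝ => f (L' * Rᵀ)) L * moorePenrose R +
          (gradient (fun R' : Matrix (Fin p₂) (Fin r) ℝ => f (L * R'ᵀ)) R * moorePenrose L)ᵀ *
            (1 - R * moorePenrose R)) ∧
    gradient (factorObjective f) (Matrix.fromRows L R) =
      Matrix.fromRows
        ((riemannianGradient (fixedRank p₁ p₂ r) f (L * Rᵀ) : Matrix (Fin p₁) (Fin p₂) ℝ) * R)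
        ((riemannianGradient (fixedRank p₁ p₂ r) f (L * Rᵀ) : Matrix (Fin p₁) (Fin p₂) ℝ)ᵀ * L) ∧
    -- both Hessians are symmetric, and their numbers of eigenvalues are as follows
    (riemannianHessian (fixedRank p₁ p₂ r) f (L * Rᵀ)).IsSymmetric ∧
    (euclideanHessian (factorObjective f) (Matrix.fromRows L R)).IsSymmetric ∧
    Multiset.card (eigenvalueMultiset (riemannianHessian (fixedRank p₁ p₂ r) f (L * Rᵀ))) =
      (p₁ + p₂ - r) * r ∧
    Multiset.card (eigenvalueMultiset
      (euclideanHessian (factorObjective f) (Matrix.fromRows L R))) = (p₁ + p₂) * r ∧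
    -- at a Euclidean first-order stationary point
    (gradient (factorObjective f) (Matrix.fromRows L R) = 0 →
      (∀ (U : Matrix (Fin p₁) (Fin r) ℝ) (U' : Matrix (Fin p₁) (Fin (p₁ - r)) ℝ) (s : Fin r → ℝ)
        (V : Matrix (Fin p₂) (Fin r) ℝ) (V' : Matrix (Fin p₂) (Fin (p₂ - r)) ℝ),
        IsCompactSVD (L * Rᵀ) U U' s V V' →
        -- for every `A`, the matrix `ξ^A` is tangent and the quadratic forms agree
        (∃ hξ : ∀ A, xiOf U U' V V' L R A ∈ tangentSpaceAt (fixedRank p₁ p₂ r) (L * Rᵀ),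
          ∀ A, ⟪euclideanHessian (factorObjective f) (Matrix.fromRows L R) A, A⟫_ℝ =
            ⟪riemannianHessian (fixedRank p₁ p₂ r) f (L * Rᵀ) ⟨xiOf U U' V V' L R A, hξ A⟩,
              ⟨xiOf U U' V V' L R A, hξ A⟩⟫_ℝ) ∧
        -- `A ↦ ξ^A` is a linear bijection of the complement of `A_null` onto the tangent space
        (∃ ℓ : nullComplement U U' V V' L R ≃ₗ[ℝ]
            tangentSpaceAt (fixedRank p₁ p₂ r) (L * Rᵀ),
          (∀ A, (ℓ A : Matrix (Fin p₁) (Fin p₂) ℝ) = xiOf U U' V V' L R A) ∧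
          (∀ ξ, ⟪riemannianHessian (fixedRank p₁ p₂ r) f (L * Rᵀ) ξ, ξ⟫_ℝ =
            ⟪euclideanHessian (factorObjective f) (Matrix.fromRows L R) (ℓ.symm ξ),
              (ℓ.symm ξ : Matrix (Fin p₁ ⊕ Fin p₂) (Fin r) ℝ)⟫_ℝ) ∧
          (∀ A : nullComplement U U' V V' L R,
            ⟪euclideanHessian (factorObjective f) (Matrix.fromRows L R) A,
              (A : Matrix (Fin p₁ ⊕ Fin p₂) (Fin r) ℝ)⟫_ℝ =
            ⟪riemannianHessian (fixedRank p₁ p₂ r) f (L * Rᵀ) (ℓ A), ℓ A⟫_ℝ)) ∧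
        -- `A_null` is an `r²`-dimensional space of eigenvectors for the eigenvalue zero
        (∀ A ∈ nullSubspace U V L R,
          euclideanHessian (factorObjective f) (Matrix.fromRows L R) A = 0) ∧
        Module.finrank ℝ (nullSubspace U V L R) = r ^ 2) ∧
      -- at least `r²` zero eigenvalues
      Multiset.replicate (r ^ 2) 0 ≤
        eigenvalueMultiset (euclideanHessian (factorObjective f) (Matrix.fromRows L R)) ∧
      -- the `i`-th largest of the remaining eigenvalues lies between the two multiples
      ∀ i ∈ Finset.Icc 1 ((p₁ + p₂ - r) * r),
        kthLargest (eigenvalueMultiset (euclideanHessian (factorObjective f)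
            (Matrix.fromRows L R)) - Multiset.replicate (r ^ 2) 0) i ∈
          Set.uIcc
            ((min (matrixSingularValue L r) (matrixSingularValue R r)) ^ 2 *
              kthLargest (eigenvalueMultiset
                (riemannianHessian (fixedRank p₁ p₂ r) f (L * Rᵀ))) i)
            (2 * (max (matrixSingularValue L 1) (matrixSingularValue R 1)) ^ 2 *
              kthLargest (eigenvalueMultiset
                (riemannianHessian (fixedRank p₁ p₂ r) f (L * Rᵀ))) i)) := by
  have hg := riemannianGradient_fixedRank (f := f) hL hR
  have hH := riemannianHessian_fixedRank_isSymmetric hf hL hR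
  have hE := euclideanHessian_isSymmetric (contDiff_factorObjective hf) (Matrix.fromRows L R)
  refine ⟨?_, ?_, hH, hE, ?_, ?_, fun h0 => ⟨?_, ?_, fun i hi =>
    kthLargest_euclideanHessian_mem_uIcc hf hL hR h0 hi⟩⟩
  · rw [hg, gradient_left hf, gradient_right hf, moorePenrose_of_rank hL, moorePenrose_of_rank hR,
      tangentProjection]
    simp only [columnProjection, Matrix.transpose_mul, Matrix.transpose_transpose,
      Matrix.transpose_inv_gram, Matrix.mul_assoc]
  · rw [gradient_factorObjective hf, hg, tangentProjection_mul hR,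
      transpose_tangentProjection_mul hL]
  · rw [card_eigenvalueMultiset hH, finrank_tangentSpaceAt_fixedRank hL hR]
  · rw [card_eigenvalueMultiset hE, Module.finrank_matrix]
    simp
  · intro U U' s V V' h
    have hxi := h.xiOf_eq hL hR
    have hnull := h.nullSubspace_eq hL hR
    refine ⟨⟨fun A => hxi A ▸ factorDeriv_mem_tangentSpaceAt hL hR A, fun A => ?_⟩, ?_, ?_, ?_⟩
    · rw [inner_euclideanHessian_of_stationary hf hL hR h0]
      simp only [hxi]
      rfl
    · let ℓ := (LinearEquiv.ofEq _ _ (h.nullComplement_eq hL hR)).trans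
        (orthogonalEquivTangent hL hR)
      have hℓ : ∀ A : nullComplement U U' V V' L R,
          ⟪euclideanHessian (factorObjective f) (Matrix.fromRows L R) A,
            (A : Matrix (Fin p₁ ⊕ Fin p₂) (Fin r) ℝ)⟫_ℝ =
          ⟪riemannianHessian (fixedRank p₁ p₂ r) f (L * Rᵀ) (ℓ A), ℓ A⟫_ℝ := fun A =>
        inner_euclideanHessian_of_stationary hf hL hR h0 A A
      refine ⟨ℓ, fun A => (hxi A).symm, fun ξ => ?_, hℓ⟩
      rw [hℓ, LinearEquiv.apply_symm_apply]
    · intro A hA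
      rw [hnull] at hA
      exact ker_factorDeriv_le_ker_euclideanHessian hf hL hR h0 hA
    · rw [hnull, finrank_ker_factorDeriv hL hR]
  · rw [eigenvalueMultiset_euclideanHessian hf hL hR h0]
    exact Multiset.le_add_right _ _
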